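/- There is an absolute constant $C$ such that the following holds. Let $n\ge 2$, let $a_{ij}$ ($1\le i\le j\le n$) be independent real random variables with $|a_{ij}|\le 1$, all with mean $0$ and common variance $\sigma^2$ ($\sigma\ge 0$; the $a_{ij}$ need not be identically distributed, and $\sigma$ may depend on $n$), and let $A$ be the symmetric $n\times n$ matrix with entries $a_{ij}$ and $a_{ji}=a_{ij}$. Let $\lambda_1(A)$ be the largest absolute value of an eigenvalue of $A$. Then $$\mathbb E[\lambda_1(A)]\ \ge\ 2\sigma\sqrt n - C\sqrt{\log n}.$$ Consequently, with probability tending to $1$ as $n\to\infty$, $\lambda_1(A)\ge 2\sigma\sqrt n - C\sqrt{\log n}$: for every $\varepsilon>0$ there is $N$ such that for all $n\ge N$ and all such matrices $A$ of order $n$, $$\Pr\bigl[\lambda_1(A)\ge 2\sigma\sqrt n - C\sqrt{\log n}\,\bigr]\ \ge\ 1-\varepsilon .$$ -/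

import Mathlib

open MeasureTheory ProbabilityTheory

/-- `lambda1 hA` is the largest absolute value of an eigenvalue of the real symmetric matrix `A`
(eigenvalues listed with multiplicity by `Matrix.IsHermitian.eigenvalues`). -/
noncomputable def lambda1 {n : ℕ} {A : Matrix (Fin n) (Fin n) ℝ} (hA : A.IsHermitian) : ℝ :=
  ⨆ i, |hA.eigenvalues i|

/-- The random symmetric matrix model: `A` is a real symmetric random matrix of order `n` whose
entries on and above the diagonal are (jointly) independent random variables with absolute
value at most `1`. No identical distribution is assumed. -/
structure IsRandomSymmetric {Ω : Type*} [MeasurableSpace Ω] (μ : Measure Ω) {n : ℕ}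
    (A : Ω → Matrix (Fin n) (Fin n) ℝ) : Prop where
  isHermitian : ∀ ω, (A ω).IsHermitian
  measurable_entry : ∀ i j, Measurable fun ω => A ω i j
  indep : iIndepFun
    (fun (p : {p : Fin n × Fin n // p.1 ≤ p.2}) (ω : Ω) => A ω p.1.1 p.1.2) μ
  abs_entry_le_one : ∀ i j, ∀ᵐ ω ∂μ, |A ω i j| ≤ 1

/-! ### Entropy of exponentials and the modified logarithmic Sobolev inequality -/

/-! The largest absolute eigenvalue is the operator norm `‖A‖`. Write `E` for its expectation and `L
= √(log n)`. The proof combines concentration of `‖A‖` above `E` with the fact that the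
self-consistent (semicircle) inequality for the resolvent has no solution when the spectral
parameter lies well below `2σ√n`.

Concentration. If `u` is a top unit eigenvector of `A`, changing the entry `(k,l)` lowers the norm
by at most `4|u_k u_l|`. The squares of these drops sum to at most 16, whatever the dimension. The
entropy method (subadditivity of entropy, a modified log-Sobolev inequality, Herbst's argument)
turns this into `𝔼 exp(s‖A‖) ≤ exp(sE + 16s²)` for `s ≥ 0` (`mgf_opNorm_le`), so `‖A‖ ≤ E + 8L`
outside an event of probability at most `1/n`.

Resolvent. Put `z = E + 8L + 1` and `R = (z - A)⁻¹`, truncated to zero on the bad event. On the good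
event the Schur complement formula gives `1/R_ii = z - a_ii - aᵀR⁽ⁱ⁾a`, where `a` is the
off-diagonal row and `R⁽ⁱ⁾` is the resolvent without row `i`, independent of `a`. Hence `R_ii ≥ 2c -
c²(z - a_ii - aᵀR⁽ⁱ⁾a)` for every `c`. Since the expectation of `aᵀR⁽ⁱ⁾a` is at least `σ²(T - 1)`,
with `T` the expected trace of the truncated resolvent, summing over `i` bounds `T` below by an
affine function of `T`. The choice `c = 1/(σ√n)` makes `T` cancel and leaves `2σ√n ≤ z + O(1)`
(`two_mul_sigma_sqrt_le`), which bounds `E` from below.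

In probability. A one-sided exponential moment suffices: `x⁺ ≤ x + e^{-x}` at `x = E - ‖A‖` bounds
the mean of `(E - ‖A‖)⁺` by a constant, and Markov's inequality at level `L` finishes. -/

lemma integrable_of_abs_le {X : Type*} [MeasurableSpace X] {μ : Measure X} [IsFiniteMeasure μ]
    {f : X → ℝ} (hf : Measurable f) {M : ℝ} (h : ∀ x, |f x| ≤ M) : Integrable f μ :=
  Integrable.of_bound hf.aestronglyMeasurable M (ae_of_all _ h)

lemma abs_exp_le {a M : ℝ} (h : |a| ≤ M) : |Real.exp a| ≤ Real.exp M := by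
  rw [abs_of_pos (Real.exp_pos _)]
  exact Real.exp_le_exp.2 ((le_abs_self _).trans h)

lemma abs_exp_mul_le {a b M K : ℝ} (h : |a| ≤ M) (hb : |b| ≤ K) :
    |Real.exp a * b| ≤ Real.exp M * K := by
  rw [abs_mul]
  exact mul_le_mul (abs_exp_le h) hb (abs_nonneg _) (Real.exp_pos _).le

/-- The entropy of `exp f` with respect to `μ`. -/
noncomputable def expEntropy {X : Type*} [MeasurableSpace X] (μ : Measure X) (f : X → ℝ) : ℝ :=
  ∫ x, Real.exp (f x) * f x ∂μ - (∫ x, Real.exp (f x) ∂μ) * Real.log (∫ x, Real.exp (f x) ∂μ)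

section Entropy

variable {X Y : Type*} [MeasurableSpace X] [MeasurableSpace Y] {μ : Measure X} {ν : Measure Y}
  [IsProbabilityMeasure μ] [IsProbabilityMeasure ν]

lemma integrable_exp_of_abs_le {f : X → ℝ} (hf : Measurable f) {M : ℝ} (h : ∀ x, |f x| ≤ M) :
    Integrable (fun x => Real.exp (f x)) μ :=
  integrable_of_abs_le (by fun_prop) fun x => abs_exp_le (h x)

lemma integrable_exp_mul_of_abs_le' {f g : X → ℝ} (hf : Measurable f) (hg : Measurable g)
    {M K : ℝ} (h : ∀ x, |f x| ≤ M) (hK : ∀ x, |g x| ≤ K) :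
    Integrable (fun x => Real.exp (f x) * g x) μ :=
  integrable_of_abs_le (by fun_prop) fun x => abs_exp_mul_le (h x) (hK x)

lemma le_integral_exp {f : X → ℝ} (hf : Measurable f) {M : ℝ} (h : ∀ x, |f x| ≤ M) :
    Real.exp (-M) ≤ ∫ x, Real.exp (f x) ∂μ := by
  have := integral_mono (μ := μ) (integrable_const (Real.exp (-M))) (integrable_exp_of_abs_le hf h)
    (fun x => Real.exp_le_exp.2 (neg_le_of_abs_le (h x)))
  simpa using this

lemma integral_exp_le {f : X → ℝ} (hf : Measurable f) {M : ℝ} (h : ∀ x, |f x| ≤ M) :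
    ∫ x, Real.exp (f x) ∂μ ≤ Real.exp M := by
  have := integral_mono (μ := μ) (integrable_exp_of_abs_le hf h) (integrable_const (Real.exp M))
    (fun x => Real.exp_le_exp.2 (le_of_abs_le (h x)))
  simpa using this

/-- Gibbs variational principle. -/
lemma integral_exp_mul_le_expEntropy {f g : X → ℝ} (hf : Measurable f) (hg : Measurable g)
    {M K : ℝ} (hM : ∀ x, |f x| ≤ M) (hK : ∀ x, |g x| ≤ K)
    (h1 : ∫ x, Real.exp (g x) ∂μ ≤ 1) :
    ∫ x, Real.exp (f x) * g x ∂μ ≤ expEntropy μ f := by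
  set Z := ∫ x, Real.exp (f x) ∂μ with hZ
  have hZpos : 0 < Z := (Real.exp_pos _).trans_le (le_integral_exp hf hM)
  -- This is `1 + t ≤ exp t` at `t = g - f + log Z`, multiplied by `exp f`; the right side
  -- integrates to at most `Z - Z = 0`.
  have hpt : ∀ x, Real.exp (f x) * g x - Real.exp (f x) * f x + Real.log Z * Real.exp (f x)
      ≤ Z * Real.exp (g x) - Real.exp (f x) := by
    intro x
    have h := Real.add_one_le_exp (g x - f x + Real.log Z)
    have h2 : Real.exp (f x) * Real.exp (g x - f x + Real.log Z) = Z * Real.exp (g x) := by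
      rw [← Real.exp_add, show f x + (g x - f x + Real.log Z) = g x + Real.log Z by ring,
        Real.exp_add, Real.exp_log hZpos, mul_comm]
    nlinarith [mul_le_mul_of_nonneg_left h (Real.exp_pos (f x)).le]
  have i1 := integrable_exp_mul_of_abs_le' (μ := μ) hf hg hM hK
  have i2 := integrable_exp_mul_of_abs_le' (μ := μ) hf hf hM hM
  have i3 := integrable_exp_of_abs_le (μ := μ) hf hM
  have i4 := integrable_exp_of_abs_le (μ := μ) hg hK
  have i12 : Integrable (fun x => Real.exp (f x) * g x - Real.exp (f x) * f x) μ := i1.sub i2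
  have h := integral_mono (i12.add (i3.const_mul (Real.log Z))) ((i4.const_mul Z).sub i3) hpt
  simp only [Pi.add_apply, Pi.sub_apply] at h
  rw [integral_add i12 (i3.const_mul _), integral_sub (i4.const_mul _) i3,
    integral_sub i1 i2, integral_const_mul, integral_const_mul, ← hZ] at h
  unfold expEntropy
  nlinarith

/-- Subadditivity of entropy on a product of two probability spaces. -/
lemma expEntropy_prod_le {f : X × Y → ℝ} (hf : Measurable f) {M : ℝ} (hM : ∀ x, |f x| ≤ M) :
    expEntropy (μ.prod ν) f ≤ ∫ x, expEntropy ν (fun y => f (x, y)) ∂μ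
      + ∫ y, expEntropy μ (fun x => f (x, y)) ∂ν := by
  set G : Y → ℝ := fun y => ∫ x, Real.exp (f (x, y)) ∂μ with hG
  set Z := ∫ y, G y ∂ν with hZ
  have hfx : ∀ x, Measurable fun y => f (x, y) := fun x => by fun_prop
  have hfy : ∀ y, Measurable fun x => f (x, y) := fun y => by fun_prop
  have hGl : ∀ y, Real.exp (-M) ≤ G y := fun y => le_integral_exp (hfy y) fun x => hM _
  have hGu : ∀ y, G y ≤ Real.exp M := fun y => integral_exp_le (hfy y) fun x => hM _
  have hGpos : ∀ y, 0 < G y := fun y => (Real.exp_pos _).trans_le (hGl y)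
  have hGm : Measurable G := by
    have : StronglyMeasurable (Function.uncurry fun y x => Real.exp (f (x, y))) := by
      apply Measurable.stronglyMeasurable
      fun_prop
    exact (this.integral_prod_right (ν := μ)).measurable
  have hGi : Integrable G ν := integrable_of_abs_le hGm (M := Real.exp M) fun y => by
    rw [abs_of_pos (hGpos y)]; exact hGu y
  have hlog : ∀ y, |Real.log (G y)| ≤ M := fun y => by
    rw [abs_le]
    constructor
    · rw [← Real.log_exp (-M)]; exact Real.log_le_log (Real.exp_pos _) (hGl y)
    · rw [← Real.log_exp M]; exact Real.log_le_log (hGpos y) (hGu y)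
  have hZl : Real.exp (-M) ≤ Z := by
    have := integral_mono (μ := ν) (integrable_const (Real.exp (-M))) hGi hGl
    simpa using this
  have hZpos : 0 < Z := (Real.exp_pos _).trans_le hZl
  have hE : Integrable (fun p => Real.exp (f p)) (μ.prod ν) := integrable_exp_of_abs_le hf hM
  have hEf : Integrable (fun p => Real.exp (f p) * f p) (μ.prod ν) :=
    integrable_exp_mul_of_abs_le' hf hf hM hM
  have hZ' : ∫ p, Real.exp (f p) ∂(μ.prod ν) = Z := integral_prod_symm _ hE
  -- The log-density of the `Y`-marginal of the tilted measure, used as a single test function in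
  -- the Gibbs principle on every fibre `{x} × Y`. The average of these bounds is exactly the
  -- entropy of the marginal `G`.
  set h : Y → ℝ := fun y => Real.log (G y) - Real.log Z with hh
  have hhm : Measurable h := by fun_prop
  have hhb : ∀ y, |h y| ≤ M + |Real.log Z| := fun y =>
    (abs_sub _ _).trans (add_le_add_left (hlog y) _)
  have hexp : ∫ y, Real.exp (h y) ∂ν ≤ 1 := by
    have : ∀ y, Real.exp (h y) = G y / Z := fun y => by
      rw [hh]; simp only [Real.exp_sub, Real.exp_log (hGpos y), Real.exp_log hZpos]
    simp only [this, integral_div]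
    rw [← hZ, div_self hZpos.ne']
  have hEh : Integrable (fun p : X × Y => Real.exp (f p) * h p.2) (μ.prod ν) :=
    integrable_exp_mul_of_abs_le' hf (by fun_prop) hM fun p => hhb p.2
  have hlogE : ∀ y, |G y * Real.log (G y)| ≤ Real.exp M * M := fun y => by
    rw [abs_mul, abs_of_pos (hGpos y)]
    exact mul_le_mul (hGu y) (hlog y) (abs_nonneg _) (Real.exp_pos _).le
  have hGlog : Integrable (fun y => G y * Real.log (G y)) ν :=
    integrable_of_abs_le (by fun_prop) hlogE
  have hmx : Measurable fun x => expEntropy ν (fun y => f (x, y)) := by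
    have s1 : StronglyMeasurable (Function.uncurry fun x y => Real.exp (f (x, y)) * f (x, y)) := by
      apply Measurable.stronglyMeasurable; fun_prop
    have s2 : StronglyMeasurable (Function.uncurry fun x y => Real.exp (f (x, y))) := by
      apply Measurable.stronglyMeasurable; fun_prop
    have m1 := (s1.integral_prod_right (ν := ν)).measurable
    have m2 := (s2.integral_prod_right (ν := ν)).measurable
    exact m1.sub (m2.mul (Real.measurable_log.comp m2))
  have hbx : ∀ x, |expEntropy ν (fun y => f (x, y))| ≤ Real.exp M * M + Real.exp M * M := by
    intro x
    have l := le_integral_exp (μ := ν) (hfx x) fun y => hM (x, y)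
    have u := integral_exp_le (μ := ν) (hfx x) fun y => hM (x, y)
    have p : 0 < ∫ y, Real.exp (f (x, y)) ∂ν := (Real.exp_pos _).trans_le l
    refine (abs_sub _ _).trans (add_le_add ?_ ?_)
    · have := norm_integral_le_of_norm_le_const (μ := ν)
        (f := fun y => Real.exp (f (x, y)) * f (x, y)) (ae_of_all _ fun y => abs_exp_mul_le (hM (x, y)) (hM (x, y)))
      simpa using this
    · rw [abs_mul, abs_of_pos p]
      refine mul_le_mul u ?_ (abs_nonneg _) (Real.exp_pos _).le
      rw [abs_le]
      constructor
      · rw [← Real.log_exp (-M)]; exact Real.log_le_log (Real.exp_pos _) l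
      · rw [← Real.log_exp M]; exact Real.log_le_log p u
  have hix := integrable_of_abs_le (μ := μ) hmx hbx
  have key : ∫ x, ∫ y, Real.exp (f (x, y)) * h y ∂ν ∂μ
      ≤ ∫ x, expEntropy ν (fun y => f (x, y)) ∂μ :=
    integral_mono hEh.integral_prod_left hix fun x =>
      integral_exp_mul_le_expEntropy (hfx x) hhm (fun y => hM _) hhb hexp
  have e1 : ∫ x, ∫ y, Real.exp (f (x, y)) * h y ∂ν ∂μ
      = ∫ y, G y * Real.log (G y) ∂ν - Z * Real.log Z := by
    rw [integral_integral_swap hEh]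
    simp only [integral_mul_const]
    have : ∀ y, (∫ x, Real.exp (f (x, y)) ∂μ) * h y
        = G y * Real.log (G y) - G y * Real.log Z := fun y => by rw [hh]; ring
    simp only [this]
    rw [integral_sub hGlog (hGi.mul_const _), integral_mul_const]
  have e2 : ∫ y, expEntropy μ (fun x => f (x, y)) ∂ν
      = ∫ p, Real.exp (f p) * f p ∂(μ.prod ν) - ∫ y, G y * Real.log (G y) ∂ν := by
    unfold expEntropy
    rw [integral_sub hEf.integral_prod_right hGlog, integral_prod_symm _ hEf]
  rw [e2]
  have e3 : expEntropy (μ.prod ν) f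
      = ∫ p, Real.exp (f p) * f p ∂(μ.prod ν) - Z * Real.log Z := by
    unfold expEntropy; rw [hZ']
  rw [e3]
  linarith

/-- For `d = a - b ≥ 0` it reduces to `1 - e^{-d} ≤ d`. The symmetrised form leaves only the
positive part of the difference, weighted by the larger exponential. -/
lemma exp_sub_mul_sub_le (a b : ℝ) :
    Real.exp a * (a - b) + Real.exp b * (b - a)
      ≤ Real.exp a * (max (a - b) 0) ^ 2 + Real.exp b * (max (b - a) 0) ^ 2 := by
  wlog h : b ≤ a generalizing a b
  · have := this b a (le_of_not_ge h)
    linarith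
  rw [max_eq_left (sub_nonneg.2 h), max_eq_right (sub_nonpos.2 h)]
  have h1 := Real.add_one_le_exp (b - a)
  have h2 : Real.exp b = Real.exp a * Real.exp (b - a) := by rw [← Real.exp_add]; ring_nf
  rw [h2]
  nlinarith [mul_nonneg (Real.exp_pos a).le (sub_nonneg.2 h),
    mul_nonneg (mul_nonneg (Real.exp_pos a).le (sub_nonneg.2 h)) (sub_nonneg.2 h1)]

lemma abs_max_sub_sq_le {a b M : ℝ} (ha : |a| ≤ M) (hb : |b| ≤ M) :
    |(max (a - b) 0) ^ 2| ≤ (2 * M) ^ 2 := by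
  rw [abs_of_nonneg (sq_nonneg _)]
  have h1 := abs_le.1 ha
  have h2 := abs_le.1 hb
  refine pow_le_pow_left₀ (le_max_right _ _) (max_le ?_ ?_) 2 <;> linarith

/-- The modified logarithmic Sobolev inequality satisfied by every probability measure. -/
lemma expEntropy_le {f : X → ℝ} (hf : Measurable f) {M : ℝ} (hM : ∀ x, |f x| ≤ M) :
    expEntropy μ f ≤ ∫ x, ∫ t, Real.exp (f x) * (max (f x - f t) 0) ^ 2 ∂μ ∂μ := by
  have hfi := integrable_of_abs_le (μ := μ) hf hM
  have hZpos : 0 < ∫ x, Real.exp (f x) ∂μ := (Real.exp_pos _).trans_le (le_integral_exp hf hM)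
  -- Jensen replaces `log Z` by the mean of `f`, so the entropy is at most an integral over two
  -- independent copies; exchanging the copies then symmetrises it.
  have jensen : ∫ x, f x ∂μ ≤ Real.log (∫ x, Real.exp (f x) ∂μ) := by
    rw [Real.le_log_iff_exp_le hZpos]
    exact convexOn_exp.map_integral_le Real.continuous_exp.continuousOn isClosed_univ
      (by simp) hfi (integrable_exp_of_abs_le hf hM)
  have i1 : Integrable (fun p : X × X => Real.exp (f p.1) * (f p.1 - f p.2)) (μ.prod μ) :=
    integrable_exp_mul_of_abs_le' (f := fun p : X × X => f p.1) (K := M + M)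
      (by fun_prop) (by fun_prop) (fun p => hM _)
      fun p => (abs_sub _ _).trans (add_le_add (hM _) (hM _))
  have i1' : Integrable (fun p : X × X => Real.exp (f p.2) * (f p.2 - f p.1)) (μ.prod μ) :=
    integrable_exp_mul_of_abs_le' (f := fun p : X × X => f p.2) (K := M + M)
      (by fun_prop) (by fun_prop) (fun p => hM _)
      fun p => (abs_sub _ _).trans (add_le_add (hM _) (hM _))
  have i2 : Integrable (fun p : X × X => Real.exp (f p.1) * (max (f p.1 - f p.2) 0) ^ 2)
      (μ.prod μ) :=
    integrable_exp_mul_of_abs_le' (f := fun p : X × X => f p.1)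
      (by fun_prop) (by fun_prop) (fun p => hM _) fun p => abs_max_sub_sq_le (hM _) (hM _)
  have i2' : Integrable (fun p : X × X => Real.exp (f p.2) * (max (f p.2 - f p.1) 0) ^ 2)
      (μ.prod μ) :=
    integrable_exp_mul_of_abs_le' (f := fun p : X × X => f p.2)
      (by fun_prop) (by fun_prop) (fun p => hM _) fun p => abs_max_sub_sq_le (hM _) (hM _)
  have step1 : expEntropy μ f ≤ ∫ p, Real.exp (f p.1) * (f p.1 - f p.2) ∂(μ.prod μ) := by
    rw [integral_prod _ i1]
    have : ∀ x, ∫ t, Real.exp (f x) * (f x - f t) ∂μ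
        = Real.exp (f x) * f x - Real.exp (f x) * ∫ t, f t ∂μ := by
      intro x
      rw [integral_const_mul, integral_sub (integrable_const _) hfi]
      simp [mul_sub]
    simp only [this]
    rw [integral_sub (integrable_exp_mul_of_abs_le' hf hf hM hM)
      ((integrable_exp_of_abs_le hf hM).mul_const _), integral_mul_const]
    unfold expEntropy
    have := mul_le_mul_of_nonneg_left jensen hZpos.le
    linarith
  have swap1 : ∫ p, Real.exp (f p.2) * (f p.2 - f p.1) ∂(μ.prod μ)
      = ∫ p, Real.exp (f p.1) * (f p.1 - f p.2) ∂(μ.prod μ) :=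
    integral_prod_swap (μ := μ) (ν := μ)
      (fun p : X × X => Real.exp (f p.1) * (f p.1 - f p.2))
  have swap2 : ∫ p, Real.exp (f p.2) * (max (f p.2 - f p.1) 0) ^ 2 ∂(μ.prod μ)
      = ∫ p, Real.exp (f p.1) * (max (f p.1 - f p.2) 0) ^ 2 ∂(μ.prod μ) :=
    integral_prod_swap (μ := μ) (ν := μ)
      (fun p : X × X => Real.exp (f p.1) * (max (f p.1 - f p.2) 0) ^ 2)
  have h := integral_mono (i1.add i1') (i2.add i2') fun p => exp_sub_mul_sub_le (f p.1) (f p.2)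
  simp only [Pi.add_apply] at h
  rw [integral_add i1 i1', integral_add i2 i2', swap1, swap2] at h
  have e := integral_prod _ i2
  simp only at e
  rw [← e]
  linarith

end Entropy

/-- Tensorized modified logarithmic Sobolev inequality on a finite product of probability
spaces. -/
lemma expEntropy_pi_le {N : ℕ} (ν : Fin N → Measure ℝ) [∀ i, IsProbabilityMeasure (ν i)]
    {f : (Fin N → ℝ) → ℝ} (hf : Measurable f) {M : ℝ} (hM : ∀ x, |f x| ≤ M) :
    expEntropy (Measure.pi ν) f ≤ ∑ i, ∫ x, ∫ t, Real.exp (f x) *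
      (max (f x - f (Function.update x i t)) 0) ^ 2 ∂(ν i) ∂(Measure.pi ν) := by
  induction N with
  | zero =>
    have : ∀ x, f x = f default := fun x => by rw [Subsingleton.elim x default]
    unfold expEntropy
    simp only [this]
    simp [mul_comm]
  | succ N ih =>
    set π := Measure.pi (fun i : Fin N => ν i.succ) with hπ
    have hmp := (measurePreserving_piFinSuccAbove ν 0).symm
    have hcons : ∀ p : ℝ × (Fin N → ℝ),
        (MeasurableEquiv.piFinSuccAbove (fun _ => ℝ) (0 : Fin (N + 1))).symm p
          = Fin.cons p.1 p.2 := fun p => by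
      simp [MeasurableEquiv.piFinSuccAbove, Fin.insertNthEquiv]
    have htr : ∀ g : (Fin (N + 1) → ℝ) → ℝ, ∫ x, g x ∂(Measure.pi ν)
        = ∫ p, g (Fin.cons p.1 p.2) ∂((ν 0).prod π) := fun g => by
      rw [← hmp.integral_comp']
      simp only [hcons]
      rfl
    have hcm : Measurable fun p : ℝ × (Fin N → ℝ) => (Fin.cons p.1 p.2 : Fin (N + 1) → ℝ) := by
      simp only [← hcons]
      exact MeasurableEquiv.measurable _
    set F : ℝ × (Fin N → ℝ) → ℝ := fun p => f (Fin.cons p.1 p.2) with hF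
    have hFm : Measurable F := hf.comp hcm
    have hFM : ∀ p, |F p| ≤ M := fun p => hM _
    have hE : expEntropy (Measure.pi ν) f = expEntropy ((ν 0).prod π) F := by
      unfold expEntropy
      rw [htr (fun x => Real.exp (f x) * f x), htr (fun x => Real.exp (f x))]
    rw [hE]
    refine (expEntropy_prod_le hFm hFM).trans ?_
    rw [Fin.sum_univ_succ, add_comm]
    have hbd : ∀ (i : Fin (N + 1)) (x) (t), |Real.exp (f x) *
        (max (f x - f (Function.update x i t)) 0) ^ 2| ≤ Real.exp M * (2 * M) ^ 2 :=
      fun i x t => abs_exp_mul_le (hM _) (abs_max_sub_sq_le (hM _) (hM _))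
    have hum : ∀ i : Fin (N + 1), Measurable
        fun p : (Fin (N + 1) → ℝ) × ℝ => Function.update p.1 i p.2 := fun i => by
      rw [measurable_pi_iff]
      intro j
      by_cases hj : j = i
      · subst hj; simpa using measurable_snd
      · simp only [Function.update_of_ne hj]; fun_prop
    have hjm : ∀ i : Fin (N + 1), Measurable fun p : (Fin (N + 1) → ℝ) × ℝ => Real.exp (f p.1) *
        (max (f p.1 - f (Function.update p.1 i p.2)) 0) ^ 2 := fun i => by
      have := hf.comp (hum i)
      simp only [Function.comp_def] at this
      fun_prop
    have hinner : ∀ i : Fin (N + 1), Measurable fun x => ∫ t, Real.exp (f x) *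
        (max (f x - f (Function.update x i t)) 0) ^ 2 ∂(ν i) := fun i =>
      ((hjm i).stronglyMeasurable.integral_prod_right' (ν := ν i)).measurable
    have hinnerb : ∀ (i : Fin (N + 1)) (x), |∫ t, Real.exp (f x) *
        (max (f x - f (Function.update x i t)) 0) ^ 2 ∂(ν i)| ≤ Real.exp M * (2 * M) ^ 2 :=
      fun i x => by
        have := norm_integral_le_of_norm_le_const (μ := ν i) (f := fun t => Real.exp (f x) *
          (max (f x - f (Function.update x i t)) 0) ^ 2) (ae_of_all _ fun t => hbd i x t)
        simpa using this
    have hint : ∀ i : Fin (N + 1), Integrable (fun p : ℝ × (Fin N → ℝ) =>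
        ∫ t, Real.exp (f (Fin.cons p.1 p.2)) * (max (f (Fin.cons p.1 p.2)
          - f (Function.update (Fin.cons p.1 p.2) i t)) 0) ^ 2 ∂(ν i)) ((ν 0).prod π) :=
      fun i => integrable_of_abs_le ((hinner i).comp hcm) fun p => hinnerb i _
    refine add_le_add ?_ ?_
    · rw [htr, integral_prod_symm _ (hint 0)]
      refine integral_mono_of_nonneg (ae_of_all _ fun y => ?_) (hint 0).integral_prod_right
        (ae_of_all _ fun y => ?_)
      -- Entropy is nonnegative, by the Gibbs principle with `g = 0`; comparison of the integrals
      -- then needs integrability of the upper bound only.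
      · refine le_trans (le_of_eq ?_) (integral_exp_mul_le_expEntropy (g := fun _ => 0)
          (M := M) (K := 0) (hFm.comp (by fun_prop : Measurable fun x : ℝ => (x, y)))
          measurable_const (fun x => hFM (x, y)) (by simp) (by simp))
        simp
      · have := expEntropy_le (μ := ν 0) (f := fun x => F (x, y))
          (hFm.comp (by fun_prop)) fun x => hFM (x, y)
        simpa [hF] using this
    · simp only [htr]
      rw [← Finset.sum_congr rfl fun i _ => (integral_prod _ (hint (Fin.succ i))).symm,
        ← integral_finsetSum _ fun i _ => (hint (Fin.succ i)).integral_prod_left]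
      refine integral_mono_of_nonneg (ae_of_all _ fun y => ?_)
        (integrable_finsetSum _ fun i _ => (hint (Fin.succ i)).integral_prod_left)
        (ae_of_all _ fun y => ?_)
      · refine le_trans (le_of_eq ?_) (integral_exp_mul_le_expEntropy (g := fun _ => 0)
          (M := M) (K := 0) (hFm.comp (by fun_prop : Measurable fun x : Fin N → ℝ => (y, x)))
          measurable_const (fun x => hFM (y, x)) (by simp) (by simp))
        simp
      · have := ih (fun i => ν i.succ) (f := fun x => F (y, x))
          (hFm.comp (by fun_prop)) fun x => hFM (y, x)
        simpa [hF, Fin.cons_update] using this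

/-- **Herbst's argument**. -/
lemma mgf_le_of_expEntropy_le {X : Type*} [MeasurableSpace X] {μ : Measure X}
    [IsProbabilityMeasure μ] {f : X → ℝ} (hf : Measurable f) {M : ℝ} (hM : ∀ x, |f x| ≤ M)
    {v : ℝ} (hv : ∀ s : ℝ, 0 < s →
      expEntropy μ (fun x => s * f x) ≤ v * s ^ 2 * ∫ x, Real.exp (s * f x) ∂μ)
    {s : ℝ} (hs : 0 ≤ s) :
    ∫ x, Real.exp (s * f x) ∂μ ≤ Real.exp (s * (∫ x, f x ∂μ) + v * s ^ 2) := by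
  have hint : ∀ t : ℝ, Integrable (fun x => Real.exp (t * f x)) μ := fun t =>
    integrable_exp_of_abs_le (M := |t| * M) (by fun_prop) fun x => by
      rw [abs_mul]; exact mul_le_mul_of_nonneg_left (hM x) (abs_nonneg t)
  have hset : integrableExpSet f μ = Set.univ := Set.eq_univ_of_forall fun t => hint t
  have hin : ∀ t, t ∈ interior (integrableExpSet f μ) := fun t => by simp [hset]
  have hpos : ∀ t, 0 < mgf f μ t := fun t => mgf_pos (hint t)
  have hder : ∀ t, HasDerivAt (cgf f μ) ((∫ x, f x * Real.exp (t * f x) ∂μ) / mgf f μ t) t :=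
    fun t => by
      have h := (hasDerivAt_mgf (hin t)).log (hpos t).ne'
      exact h
  rcases hs.eq_or_lt with rfl | hs
  · simp
  have hineq : ∀ t : ℝ, 0 < t → t * ((∫ x, f x * Real.exp (t * f x) ∂μ) / mgf f μ t)
      - cgf f μ t ≤ v * t ^ 2 := by
    intro t ht
    have h := hv t ht
    unfold expEntropy at h
    have e : ∫ x, Real.exp (t * f x) * (t * f x) ∂μ = t * ∫ x, f x * Real.exp (t * f x) ∂μ := by
      rw [← integral_const_mul]; congr 1; ext x; ring
    rw [e] at h
    change t * (∫ x, f x * Real.exp (t * f x) ∂μ) - mgf f μ t * cgf f μ t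
      ≤ v * t ^ 2 * mgf f μ t at h
    rw [← sub_nonneg] at h ⊢
    have : v * t ^ 2 - (t * ((∫ x, f x * Real.exp (t * f x) ∂μ) / mgf f μ t) - cgf f μ t)
        = (v * t ^ 2 * mgf f μ t - (t * (∫ x, f x * Real.exp (t * f x) ∂μ)
          - mgf f μ t * cgf f μ t)) / mgf f μ t := by
      field_simp [(hpos t).ne']
    rw [this]
    exact div_nonneg h (hpos t).le
  -- The entropy bound says exactly that `H` has nonpositive derivative; its limit at `0+` is the
  -- mean of `f`.
  set H : ℝ → ℝ := fun t => cgf f μ t / t - v * t with hH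
  have hHd : ∀ t : ℝ, 0 < t → HasDerivAt H
      ((((∫ x, f x * Real.exp (t * f x) ∂μ) / mgf f μ t) * t - cgf f μ t * 1) / t ^ 2 - v * 1) t :=
    fun t ht => ((hder t).div (hasDerivAt_id t) ht.ne').sub ((hasDerivAt_id t).const_mul v)
  have hanti : AntitoneOn H (Set.Ioi 0) := by
    refine antitoneOn_of_deriv_nonpos (convex_Ioi 0)
      (fun t ht => (hHd t ht).continuousAt.continuousWithinAt)
      (fun t ht => (hHd t (by simpa using ht)).differentiableAt.differentiableWithinAt) ?_
    intro t ht
    have ht : 0 < t := by simpa using ht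
    rw [(hHd t ht).deriv, sub_nonpos, div_le_iff₀ (by positivity)]
    have := hineq t ht
    linarith
  have hlim : Filter.Tendsto H (nhdsWithin 0 (Set.Ioi 0)) (nhds (∫ x, f x ∂μ)) := by
    have h0 := hder 0
    rw [hasDerivAt_iff_tendsto_slope] at h0
    have h1 : Filter.Tendsto (fun t => cgf f μ t / t) (nhdsWithin 0 (Set.Ioi 0))
        (nhds (∫ x, f x ∂μ)) := by
      have h2 := h0.mono_left (nhdsWithin_mono (0 : ℝ) (s := Set.Ioi 0)
        (fun t (ht : 0 < t) => (ht.ne' : t ≠ 0)))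
      simp only [zero_mul, Real.exp_zero, mul_one, mgf_zero, div_one] at h2
      refine h2.congr fun t => ?_
      simp [slope_def_field]
    have h3 : Filter.Tendsto (fun t : ℝ => v * t) (nhdsWithin 0 (Set.Ioi 0)) (nhds 0) := by
      have : Filter.Tendsto (fun t : ℝ => v * t) (nhds 0) (nhds (v * 0)) :=
        (continuous_const.mul continuous_id).tendsto 0
      rw [mul_zero] at this
      exact this.mono_left nhdsWithin_le_nhds
    simpa using h1.sub h3
  have hle : H s ≤ ∫ x, f x ∂μ := by
    refine ge_of_tendsto hlim ?_
    filter_upwards [Ioo_mem_nhdsGT hs] with t ht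
    exact hanti ht.1 hs ht.2.le
  have hc : cgf f μ s ≤ s * (∫ x, f x ∂μ) + v * s ^ 2 := by
    have h : cgf f μ s / s ≤ (∫ x, f x ∂μ) + v * s := by
      simp only [hH] at hle; linarith
    rw [div_le_iff₀ hs] at h
    nlinarith
  exact (Real.log_le_iff_le_exp (hpos s)).1 hc

/-- Functions on a product space with bounded sum of squared one-sided discrete derivatives have
a sub-Gaussian upper tail. -/
lemma mgf_pi_le {N : ℕ} (ν : Fin N → Measure ℝ) [∀ i, IsProbabilityMeasure (ν i)]
    {f : (Fin N → ℝ) → ℝ} (hf : Measurable f) {M : ℝ} (hM : ∀ x, |f x| ≤ M) {v : ℝ}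
    (hv : ∀ x x' : Fin N → ℝ, ∑ i, (max (f x - f (Function.update x i (x' i))) 0) ^ 2 ≤ v)
    {s : ℝ} (hs : 0 ≤ s) :
    ∫ x, Real.exp (s * f x) ∂(Measure.pi ν)
      ≤ Real.exp (s * (∫ x, f x ∂(Measure.pi ν)) + v * s ^ 2) := by
  refine mgf_le_of_expEntropy_le hf hM (fun r hr => ?_) hs
  set π := Measure.pi ν with hπ
  have hrM : ∀ x, |r * f x| ≤ r * M := fun x => by
    rw [abs_mul, abs_of_pos hr]; exact mul_le_mul_of_nonneg_left (hM x) hr.le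
  have hum : ∀ i : Fin N, Measurable
      fun p : (Fin N → ℝ) × (Fin N → ℝ) => Function.update p.1 i (p.2 i) := fun i => by
    rw [measurable_pi_iff]
    intro j
    by_cases hj : j = i
    · subst hj; simp only [Function.update_self]; fun_prop
    · simp only [Function.update_of_ne hj]; fun_prop
  have hfu : ∀ i : Fin N, Measurable fun p : (Fin N → ℝ) × (Fin N → ℝ) =>
      f (Function.update p.1 i (p.2 i)) := fun i => hf.comp (hum i)
  have hI : ∀ i : Fin N, Integrable (fun p : (Fin N → ℝ) × (Fin N → ℝ) => Real.exp (r * f p.1) *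
      (max (r * f p.1 - r * f (Function.update p.1 i (p.2 i))) 0) ^ 2) (π.prod π) := fun i =>
    integrable_exp_mul_of_abs_le' (f := fun p : (Fin N → ℝ) × (Fin N → ℝ) => r * f p.1)
      (by fun_prop) (by have := hfu i; fun_prop) (fun p => hrM _)
      fun p => abs_max_sub_sq_le (hrM _) (hrM _)
  -- All resampled coordinates are drawn from one independent copy of the whole vector, so that `hv`
  -- bounds the sum over `i` pointwise.
  have hcoord : ∀ i : Fin N, ∫ x, ∫ t, Real.exp (r * f x) *
      (max (r * f x - r * f (Function.update x i t)) 0) ^ 2 ∂(ν i) ∂π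
      = ∫ p, Real.exp (r * f p.1) *
      (max (r * f p.1 - r * f (Function.update p.1 i (p.2 i))) 0) ^ 2 ∂(π.prod π) := fun i => by
    rw [integral_prod _ (hI i)]
    congr 1
    ext x
    have hm : Measurable fun t : ℝ => f (Function.update x i t) :=
      hf.comp (measurable_update x)
    rw [← (measurePreserving_eval ν i).map_eq, integral_map (measurable_pi_apply i).aemeasurable
      (Measurable.aestronglyMeasurable (by fun_prop))]
  refine (expEntropy_pi_le ν (f := fun x => r * f x) (by fun_prop) hrM).trans ?_
  rw [Finset.sum_congr rfl fun i _ => hcoord i, ← integral_finsetSum _ fun i _ => hI i]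
  have hbound : ∀ p : (Fin N → ℝ) × (Fin N → ℝ), ∑ i, Real.exp (r * f p.1) *
      (max (r * f p.1 - r * f (Function.update p.1 i (p.2 i))) 0) ^ 2
      ≤ v * r ^ 2 * Real.exp (r * f p.1) := by
    intro p
    have : ∀ i, (max (r * f p.1 - r * f (Function.update p.1 i (p.2 i))) 0) ^ 2
        = r ^ 2 * (max (f p.1 - f (Function.update p.1 i (p.2 i))) 0) ^ 2 := fun i => by
      rw [← mul_pow, mul_max_of_nonneg _ _ hr.le, mul_zero, mul_sub]
    simp only [this]
    rw [← Finset.mul_sum, ← Finset.mul_sum]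
    have h1 := mul_le_mul_of_nonneg_left (hv p.1 p.2)
      (mul_nonneg (Real.exp_pos (r * f p.1)).le (sq_nonneg r))
    linarith
  have hE : Integrable (fun x => Real.exp (r * f x)) π :=
    integrable_exp_of_abs_le (by fun_prop) hrM
  have h := integral_mono (integrable_finsetSum _ fun i _ => hI i)
    ((hE.comp_fst π).const_mul (v * r ^ 2)) hbound
  refine h.trans (le_of_eq ?_)
  rw [integral_const_mul, integral_fun_fst fun x => Real.exp (r * f x)]
  simp

open scoped Matrix

/-! ### The operator norm of a real symmetric matrix -/

section OpNorm

variable {n : ℕ}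

/-- The operator norm of a real square matrix acting on Euclidean space. -/
noncomputable def opNorm (A : Matrix (Fin n) (Fin n) ℝ) : ℝ :=
  ‖Matrix.toEuclideanCLM (n := Fin n) (𝕜 := ℝ) A‖

lemma opNorm_nonneg (A : Matrix (Fin n) (Fin n) ℝ) : 0 ≤ opNorm A := norm_nonneg _

lemma continuous_opNorm : Continuous (opNorm : Matrix (Fin n) (Fin n) ℝ → ℝ) :=
  continuous_norm.comp (LinearMap.continuous_of_finiteDimensional
    (Matrix.toEuclideanCLM (n := Fin n) (𝕜 := ℝ)).toAlgEquiv.toLinearMap)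

lemma measurable_opNorm_comp {Ω : Type*} [MeasurableSpace Ω] {A : Ω → Matrix (Fin n) (Fin n) ℝ}
    (hA : ∀ i j, Measurable fun ω => A ω i j) : Measurable fun ω => opNorm (A ω) := by
  have h1 : Measurable fun ω => fun i j => A ω i j :=
    measurable_pi_iff.2 fun i => measurable_pi_iff.2 fun j => hA i j
  have h2 : Continuous fun B : Fin n → Fin n → ℝ => opNorm (Matrix.of B) := continuous_opNorm
  exact h2.measurable.comp h1

lemma norm_toLp_sq (x : Fin n → ℝ) : ‖WithLp.toLp 2 x‖ ^ 2 = x ⬝ᵥ x := by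
  rw [EuclideanSpace.real_norm_sq_eq]
  simp [dotProduct, sq]

lemma abs_dotProduct_le (x y : Fin n → ℝ) :
    |x ⬝ᵥ y| ≤ ‖WithLp.toLp 2 x‖ * ‖WithLp.toLp 2 y‖ := by
  have := abs_real_inner_le_norm (WithLp.toLp 2 y) (WithLp.toLp 2 x)
  rw [EuclideanSpace.inner_toLp_toLp] at this
  simpa [mul_comm] using this

lemma norm_mulVec_le (A : Matrix (Fin n) (Fin n) ℝ) (x : Fin n → ℝ) :
    ‖WithLp.toLp 2 (A *ᵥ x)‖ ≤ opNorm A * ‖WithLp.toLp 2 x‖ :=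
  (Matrix.toEuclideanCLM (n := Fin n) (𝕜 := ℝ) A).le_opNorm (WithLp.toLp 2 x)

lemma abs_quadForm_le (A : Matrix (Fin n) (Fin n) ℝ) (x : Fin n → ℝ) :
    |x ⬝ᵥ A *ᵥ x| ≤ opNorm A * (x ⬝ᵥ x) := by
  refine (abs_dotProduct_le _ _).trans ?_
  rw [← norm_toLp_sq]
  nlinarith [norm_mulVec_le A x, norm_nonneg (WithLp.toLp 2 x)]

lemma dotProduct_eigenvectorBasis {A : Matrix (Fin n) (Fin n) ℝ} (hA : A.IsHermitian) (i : Fin n) :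
    (hA.eigenvectorBasis i : Fin n → ℝ) ⬝ᵥ (hA.eigenvectorBasis i : Fin n → ℝ) = 1 := by
  rw [← norm_toLp_sq]
  simp

lemma abs_eigenvalues_eq {A : Matrix (Fin n) (Fin n) ℝ} (hA : A.IsHermitian) (i : Fin n) :
    |(hA.eigenvectorBasis i : Fin n → ℝ) ⬝ᵥ A *ᵥ (hA.eigenvectorBasis i : Fin n → ℝ)|
      = |hA.eigenvalues i| := by
  rw [Matrix.IsHermitian.mulVec_eigenvectorBasis, dotProduct_smul, dotProduct_eigenvectorBasis]
  simp

lemma abs_eigenvalues_le_opNorm {A : Matrix (Fin n) (Fin n) ℝ} (hA : A.IsHermitian) (i : Fin n) :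
    |hA.eigenvalues i| ≤ opNorm A := by
  have := abs_quadForm_le A (hA.eigenvectorBasis i : Fin n → ℝ)
  rwa [abs_eigenvalues_eq, dotProduct_eigenvectorBasis, mul_one] at this

/-- In an orthonormal eigenbasis `‖Ax‖²` is the sum of `λ_i² ⟨e_i, x⟩²`. The norm is manifestly
continuous in the matrix, which yields measurability. -/
lemma lambda1_eq_opNorm {A : Matrix (Fin n) (Fin n) ℝ} (hA : A.IsHermitian) :
    lambda1 hA = opNorm A := by
  refine le_antisymm (Real.iSup_le (abs_eigenvalues_le_opNorm hA) (opNorm_nonneg A)) ?_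
  have h0 : 0 ≤ lambda1 hA := Real.iSup_nonneg fun i => abs_nonneg _
  have hle : ∀ i, |hA.eigenvalues i| ≤ lambda1 hA := fun i =>
    le_ciSup (f := fun i => |hA.eigenvalues i|) (Set.finite_range _).bddAbove i
  refine ContinuousLinearMap.opNorm_le_bound _ h0 fun x => ?_
  set T := Matrix.toEuclideanCLM (n := Fin n) (𝕜 := ℝ) A with hT
  have hTe : ∀ i, T (hA.eigenvectorBasis i) = hA.eigenvalues i • hA.eigenvectorBasis i := by
    intro i
    have := hA.mulVec_eigenvectorBasis i
    ext j
    exact congrFun this j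
  have hTs : ∀ i, inner ℝ (hA.eigenvectorBasis i) (T x)
      = hA.eigenvalues i * inner ℝ (hA.eigenvectorBasis i) x := by
    intro i
    have hsymm : (Matrix.toEuclideanLin A).IsSymmetric :=
      Matrix.isSymmetric_toEuclideanLin_iff.mpr hA
    have h1 := hsymm (hA.eigenvectorBasis i) x
    change inner ℝ (T (hA.eigenvectorBasis i)) x = inner ℝ (hA.eigenvectorBasis i) (T x) at h1
    rw [← h1, hTe, real_inner_smul_left]
  have hsq : ‖T x‖ ^ 2 ≤ (lambda1 hA * ‖x‖) ^ 2 := by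
    rw [← hA.eigenvectorBasis.sum_sq_norm_inner_right (T x), mul_pow,
      ← hA.eigenvectorBasis.sum_sq_norm_inner_right x, Finset.mul_sum]
    refine Finset.sum_le_sum fun i _ => ?_
    rw [hTs, norm_mul, mul_pow]
    exact mul_le_mul_of_nonneg_right
      (pow_le_pow_left₀ (abs_nonneg _) (hle i) 2) (sq_nonneg _)
  exact le_of_sq_le_sq hsq (by positivity)

lemma exists_abs_quadForm_eq_opNorm (hn : 0 < n) {A : Matrix (Fin n) (Fin n) ℝ}
    (hA : A.IsHermitian) : ∃ u : Fin n → ℝ, u ⬝ᵥ u = 1 ∧ |u ⬝ᵥ A *ᵥ u| = opNorm A := by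
  have : Nonempty (Fin n) := ⟨⟨0, hn⟩⟩
  obtain ⟨i, hi⟩ := exists_eq_ciSup_of_finite (f := fun i => |hA.eigenvalues i|)
  refine ⟨hA.eigenvectorBasis i, dotProduct_eigenvectorBasis hA i, ?_⟩
  rw [abs_eigenvalues_eq, hi, ← lambda1_eq_opNorm hA]
  rfl

lemma quadForm_eq_sum (A : Matrix (Fin n) (Fin n) ℝ) (u : Fin n → ℝ) :
    u ⬝ᵥ A *ᵥ u = ∑ i, ∑ j, A i j * (u i * u j) := by
  simp only [dotProduct, Matrix.mulVec, Finset.mul_sum]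
  exact Finset.sum_congr rfl fun i _ => Finset.sum_congr rfl fun j _ => by ring

lemma sq_le_one_of_dotProduct_self {u : Fin n → ℝ} (hu : u ⬝ᵥ u = 1) (i : Fin n) :
    u i ^ 2 ≤ 1 := by
  rw [← hu, sq]
  exact Finset.single_le_sum (f := fun i => u i * u i) (fun j _ => mul_self_nonneg _)
    (Finset.mem_univ i)

lemma opNorm_le_of_abs_entry_le_one (hn : 0 < n) {A : Matrix (Fin n) (Fin n) ℝ}
    (hA : A.IsHermitian) (h : ∀ i j, |A i j| ≤ 1) : opNorm A ≤ n * n := by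
  obtain ⟨u, hu, he⟩ := exists_abs_quadForm_eq_opNorm hn hA
  have hu1 : ∀ i, |u i| ≤ 1 := fun i => by
    have := sq_le_one_of_dotProduct_self hu i
    rwa [sq_le_one_iff_abs_le_one] at this
  rw [← he, quadForm_eq_sum]
  refine (Finset.abs_sum_le_sum_abs _ _).trans ?_
  have : ∀ i ∈ Finset.univ, |∑ j, A i j * (u i * u j)| ≤ (n : ℝ) := fun i _ => by
    refine (Finset.abs_sum_le_sum_abs _ _).trans ?_
    have : ∀ j ∈ Finset.univ, |A i j * (u i * u j)| ≤ 1 := fun j _ => by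
      rw [abs_mul, abs_mul]
      exact mul_le_one₀ (h i j) (by positivity)
        (mul_le_one₀ (hu1 i) (abs_nonneg _) (hu1 j))
    simpa using Finset.sum_le_card_nsmul _ _ _ this
  simpa using Finset.sum_le_card_nsmul _ _ _ this

/-- Changing one symmetric pair of entries, the operator norm drops by at most four times the
product of the corresponding coordinates of a top eigenvector. -/
lemma opNorm_sub_le {A B : Matrix (Fin n) (Fin n) ℝ} {u : Fin n → ℝ} (hu : u ⬝ᵥ u = 1)
    (he : |u ⬝ᵥ A *ᵥ u| = opNorm A) {k l : Fin n}
    (hAB : ∀ i j, |A i j - B i j| ≤ 2)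
    (hkl : ∀ i j, ¬ (i = k ∧ j = l) → ¬ (i = l ∧ j = k) → A i j = B i j) :
    opNorm A - opNorm B ≤ 4 * |u k * u l| := by
  have h1 : |u ⬝ᵥ B *ᵥ u| ≤ opNorm B := by
    have := abs_quadForm_le B u
    rwa [hu, mul_one] at this
  have h2 : opNorm A - opNorm B ≤ |u ⬝ᵥ A *ᵥ u - u ⬝ᵥ B *ᵥ u| := by
    have := abs_sub_abs_le_abs_sub (u ⬝ᵥ A *ᵥ u) (u ⬝ᵥ B *ᵥ u)
    linarith
  refine h2.trans ?_
  rw [quadForm_eq_sum, quadForm_eq_sum, ← Finset.sum_sub_distrib]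
  simp only [← Finset.sum_sub_distrib]
  refine (Finset.abs_sum_le_sum_abs _ _).trans ((Finset.sum_le_sum fun i _ =>
    Finset.abs_sum_le_sum_abs _ _).trans ?_)
  -- The two positions `(k,l)` and `(l,k)` are counted separately; on the diagonal this merely
  -- counts twice.
  have hb : ∀ i j, |A i j * (u i * u j) - B i j * (u i * u j)|
      ≤ (if i = k then (if j = l then 2 * |u k * u l| else 0) else 0)
        + (if i = l then (if j = k then 2 * |u k * u l| else 0) else 0) := by
    intro i j
    rw [← sub_mul, abs_mul]
    have hpos : 0 ≤ 2 * |u k * u l| := by positivity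
    by_cases h1 : i = k ∧ j = l
    · obtain ⟨rfl, rfl⟩ := h1
      have := mul_le_mul_of_nonneg_right (hAB i j) (abs_nonneg (u i * u j))
      simp only [if_true]
      split_ifs <;> linarith
    · by_cases h2 : i = l ∧ j = k
      · obtain ⟨rfl, rfl⟩ := h2
        have := mul_le_mul_of_nonneg_right (hAB i j) (abs_nonneg (u i * u j))
        rw [mul_comm (u j) (u i)]
        rw [mul_comm (u j) (u i)] at hpos
        simp only [if_true]
        split_ifs <;> linarith
      · rw [hkl i j h1 h2, sub_self, abs_zero, zero_mul]
        split_ifs <;> linarith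
  refine (Finset.sum_le_sum fun i _ => Finset.sum_le_sum fun j _ => hb i j).trans (le_of_eq ?_)
  simp [Finset.sum_add_distrib]
  ring

end OpNorm

/-! ### Sub-Gaussian upper tail of the operator norm -/

section Concentration

variable {n : ℕ}

/-- The symmetric matrix with given entries on and above the diagonal, truncated to `[-1, 1]`. -/
def clippedSymm (x : {p : Fin n × Fin n // p.1 ≤ p.2} → ℝ) : Matrix (Fin n) (Fin n) ℝ :=
  Matrix.of fun i j => max (-1) (min (x ⟨(min i j, max i j), min_le_max⟩) 1)

lemma clippedSymm_isHermitian (x : {p : Fin n × Fin n // p.1 ≤ p.2} → ℝ) :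
    (clippedSymm x).IsHermitian := by
  ext i j
  simp [clippedSymm, min_comm, max_comm]

lemma abs_clippedSymm_le (x : {p : Fin n × Fin n // p.1 ≤ p.2} → ℝ) (i j : Fin n) :
    |clippedSymm x i j| ≤ 1 := by
  rw [abs_le]
  exact ⟨le_max_left _ _, max_le (by norm_num) (min_le_right _ _)⟩

lemma clippedSymm_eq {A : Matrix (Fin n) (Fin n) ℝ} (hA : A.IsHermitian)
    (h : ∀ i j, |A i j| ≤ 1) : clippedSymm (fun p => A p.1.1 p.1.2) = A := by
  ext i j
  have hs : A (min i j) (max i j) = A i j := by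
    rcases le_total i j with hij | hij
    · rw [min_eq_left hij, max_eq_right hij]
    · rw [min_eq_right hij, max_eq_left hij]
      simpa using hA.apply i j
  have := abs_le.1 (h i j)
  simp only [clippedSymm, Matrix.of_apply, hs]
  rw [min_eq_left this.2, max_eq_right this.1]

/-- The same top eigenvector `u` of the original matrix serves for every changed entry, and the sum
of `u_k² u_l²` over all pairs is `(∑ u_k²)² = 1`. -/
lemma sum_sq_opNorm_clippedSymm_sub_le (hn : 0 < n)
    (x x' : {p : Fin n × Fin n // p.1 ≤ p.2} → ℝ) :
    ∑ p, (max (opNorm (clippedSymm x) - opNorm (clippedSymm (Function.update x p (x' p)))) 0) ^ 2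
      ≤ 16 := by
  obtain ⟨u, hu, he⟩ := exists_abs_quadForm_eq_opNorm hn (clippedSymm_isHermitian x)
  have hp : ∀ p : {p : Fin n × Fin n // p.1 ≤ p.2},
      (max (opNorm (clippedSymm x) - opNorm (clippedSymm (Function.update x p (x' p)))) 0) ^ 2
        ≤ 16 * (u p.1.1 ^ 2 * u p.1.2 ^ 2) := by
    intro p
    have h := opNorm_sub_le (B := clippedSymm (Function.update x p (x' p))) hu he
      (k := p.1.1) (l := p.1.2)
      (fun i j => (abs_sub _ _).trans (by
        have h1 := abs_clippedSymm_le x i j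
        have h2 := abs_clippedSymm_le (Function.update x p (x' p)) i j
        linarith))
      (fun i j h1 h2 => by
        have hne : (⟨(min i j, max i j), min_le_max⟩ : {p : Fin n × Fin n // p.1 ≤ p.2}) ≠ p := by
          rintro rfl
          rcases le_total i j with hij | hij
          · exact h1 ⟨by simp [hij], by simp [hij]⟩
          · exact h2 ⟨by simp [hij], by simp [hij]⟩
        simp [clippedSymm, Function.update_of_ne hne])
    calc _ ≤ (4 * |u p.1.1 * u p.1.2|) ^ 2 :=
          pow_le_pow_left₀ (le_max_right _ _) (max_le h (by positivity)) 2
      _ = _ := by rw [mul_pow, sq_abs]; ring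
  calc _ ≤ ∑ p : {p : Fin n × Fin n // p.1 ≤ p.2}, 16 * (u p.1.1 ^ 2 * u p.1.2 ^ 2) :=
        Finset.sum_le_sum fun p _ => hp p
    _ ≤ ∑ p : Fin n × Fin n, 16 * (u p.1 ^ 2 * u p.2 ^ 2) := by
        refine (Finset.sum_map Finset.univ
          (Function.Embedding.subtype fun p : Fin n × Fin n => p.1 ≤ p.2)
          (fun p : Fin n × Fin n => 16 * (u p.1 ^ 2 * u p.2 ^ 2))).ge.trans ?_
        exact Finset.sum_le_sum_of_subset_of_nonneg (Finset.subset_univ _)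
          fun p _ _ => by positivity
    _ = 16 * ((u ⬝ᵥ u) * (u ⬝ᵥ u)) := by
        rw [← Finset.mul_sum, Fintype.sum_prod_type, dotProduct, Finset.sum_mul_sum]
        simp only [sq]
    _ = 16 := by rw [hu]; norm_num

variable {Ω : Type*} [MeasurableSpace Ω] {μ : Measure Ω}
  {A : Ω → Matrix (Fin n) (Fin n) ℝ}

lemma IsRandomSymmetric.ae_abs_le (hA : IsRandomSymmetric μ A) :
    ∀ᵐ ω ∂μ, ∀ i j, |A ω i j| ≤ 1 := by
  simp only [ae_all_iff]
  exact hA.abs_entry_le_one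

lemma IsRandomSymmetric.measurable_opNorm (hA : IsRandomSymmetric μ A) :
    Measurable fun ω => opNorm (A ω) :=
  measurable_opNorm_comp hA.measurable_entry

lemma IsRandomSymmetric.ae_opNorm_le (hn : 0 < n) (hA : IsRandomSymmetric μ A) :
    ∀ᵐ ω ∂μ, opNorm (A ω) ≤ n * n := by
  filter_upwards [hA.ae_abs_le] with ω h
  exact opNorm_le_of_abs_entry_le_one hn (hA.isHermitian ω) h

variable [IsProbabilityMeasure μ]

lemma IsRandomSymmetric.integrable_opNorm (hn : 0 < n) (hA : IsRandomSymmetric μ A) :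
    Integrable (fun ω => opNorm (A ω)) μ :=
  Integrable.of_bound hA.measurable_opNorm.aestronglyMeasurable (n * n) (by
    filter_upwards [hA.ae_opNorm_le hn] with ω h
    rwa [Real.norm_of_nonneg (opNorm_nonneg _)])

lemma IsRandomSymmetric.integrable_exp_opNorm (hn : 0 < n) (hA : IsRandomSymmetric μ A) {s : ℝ}
    (hs : 0 ≤ s) : Integrable (fun ω => Real.exp (s * opNorm (A ω))) μ :=
  Integrable.of_bound (Real.measurable_exp.comp
    (hA.measurable_opNorm.const_mul s)).aestronglyMeasurable (Real.exp (s * (n * n))) (by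
    filter_upwards [hA.ae_opNorm_le hn] with ω h
    rw [Real.norm_of_nonneg (Real.exp_pos _).le]
    exact Real.exp_le_exp.2 (mul_le_mul_of_nonneg_left h hs))

/-- Independence makes the joint law of the upper entries a product measure. Clipping makes the
bounds hold at every point of the product space and changes `A` only on a null set. -/
theorem IsRandomSymmetric.mgf_opNorm_le (hn : 0 < n) (hA : IsRandomSymmetric μ A) {s : ℝ}
    (hs : 0 ≤ s) :
    ∫ ω, Real.exp (s * opNorm (A ω)) ∂μ
      ≤ Real.exp (s * (∫ ω, opNorm (A ω) ∂μ) + 16 * s ^ 2) := by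
  let e := (Fintype.equivFin {p : Fin n × Fin n // p.1 ≤ p.2}).symm
  set X : Fin (Fintype.card {p : Fin n × Fin n // p.1 ≤ p.2}) → Ω → ℝ :=
    fun k ω => A ω (e k).1.1 (e k).1.2 with hX
  have hXm : ∀ k, Measurable (X k) := fun k => hA.measurable_entry _ _
  have hind : iIndepFun X μ := hA.indep.precomp e.injective
  have hmap := (iIndepFun_iff_map_fun_eq_pi_map fun k => (hXm k).aemeasurable).1 hind
  have : ∀ k, IsProbabilityMeasure (μ.map (X k)) := fun k =>
    Measure.isProbabilityMeasure_map (hXm k).aemeasurable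
  set f : (Fin (Fintype.card {p : Fin n × Fin n // p.1 ≤ p.2}) → ℝ) → ℝ :=
    fun x => opNorm (clippedSymm fun p => x (e.symm p)) with hf
  have hfm : Measurable f := measurable_opNorm_comp fun i j => by
    simp only [clippedSymm, Matrix.of_apply]
    fun_prop
  have hfb : ∀ x, |f x| ≤ n * n := fun x => by
    rw [abs_of_nonneg (opNorm_nonneg _)]
    exact opNorm_le_of_abs_entry_le_one hn (clippedSymm_isHermitian _) (abs_clippedSymm_le _)
  have hv : ∀ x x' : Fin (Fintype.card {p : Fin n × Fin n // p.1 ≤ p.2}) → ℝ,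
      ∑ i, (max (f x - f (Function.update x i (x' i))) 0) ^ 2 ≤ 16 := by
    intro x x'
    refine le_trans (le_of_eq ?_) (sum_sq_opNorm_clippedSymm_sub_le hn (fun p => x (e.symm p))
      (fun p => x' (e.symm p)))
    rw [← e.sum_comp]
    refine Finset.sum_congr rfl fun k _ => ?_
    have : (fun p => Function.update x k (x' k) (e.symm p))
        = Function.update (fun p => x (e.symm p)) (e k) (x' (e.symm (e k))) := by
      ext p
      by_cases hp : p = e k
      · subst hp; simp
      · have : e.symm p ≠ k := fun h => hp (by rw [← h]; simp)
        rw [Function.update_of_ne hp, Function.update_of_ne this]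
    simp only [hf, this]
  have main := mgf_pi_le (fun k => μ.map (X k)) hfm hfb hv hs
  have hXall : Measurable fun ω k => X k ω := measurable_pi_iff.2 hXm
  have hae : ∀ᵐ ω ∂μ, f (fun k => X k ω) = opNorm (A ω) := by
    filter_upwards [hA.ae_abs_le] with ω h
    simp only [hf, hX, Equiv.apply_symm_apply]
    rw [clippedSymm_eq (hA.isHermitian ω) h]
  rw [← hmap, integral_map hXall.aemeasurable (by fun_prop),
    integral_map hXall.aemeasurable (by fun_prop)] at main
  rw [integral_congr_ae hae] at main
  refine le_trans (le_of_eq (integral_congr_ae ?_)) main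
  filter_upwards [hae] with ω h
  rw [h]

/-- Sub-Gaussian upper tail of the operator norm of a random symmetric matrix. -/
theorem IsRandomSymmetric.measureReal_opNorm_ge_le (hn : 0 < n) (hA : IsRandomSymmetric μ A)
    {t : ℝ} (ht : 0 ≤ t) :
    μ.real {ω | (∫ ω, opNorm (A ω) ∂μ) + t ≤ opNorm (A ω)} ≤ Real.exp (-t ^ 2 / 64) := by
  -- The Chernoff parameter minimising `16s² - st`.
  have hs : 0 ≤ t / 32 := by positivity
  have h := measure_ge_le_exp_mul_mgf ((∫ ω, opNorm (A ω) ∂μ) + t) hs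
    (hA.integrable_exp_opNorm hn hs)
  refine h.trans ((mul_le_mul_of_nonneg_left (hA.mgf_opNorm_le hn hs)
    (Real.exp_pos _).le).trans (le_of_eq ?_))
  rw [← Real.exp_add]
  congr 1
  ring

end Concentration

/-! ### Resolvents and removal of a row -/

section Resolvent

variable {n : ℕ}

/-! ### Inverses of matrices whose quadratic form dominates the identity -/

section Coercive

variable {M : Matrix (Fin n) (Fin n) ℝ}

lemma isUnit_det_of_coercive (hc : ∀ x, x ⬝ᵥ x ≤ x ⬝ᵥ M *ᵥ x) : IsUnit M.det := by
  rw [isUnit_iff_ne_zero]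
  intro h
  obtain ⟨v, hv, h0⟩ := Matrix.exists_mulVec_eq_zero_iff.2 h
  have := hc v
  rw [h0, dotProduct_zero] at this
  exact hv (dotProduct_self_eq_zero.1
    (le_antisymm this (Finset.sum_nonneg fun _ _ => mul_self_nonneg _)))

lemma mulVec_inv_mulVec (hc : ∀ x, x ⬝ᵥ x ≤ x ⬝ᵥ M *ᵥ x) (x : Fin n → ℝ) :
    M *ᵥ (M⁻¹ *ᵥ x) = x := by
  rw [Matrix.mulVec_mulVec, Matrix.mul_nonsing_inv _ (isUnit_det_of_coercive hc),
    Matrix.one_mulVec]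

/-- Coercivity evaluated at `M⁻¹x`. For symmetric `M` this reads `R² ≤ R` with `R = M⁻¹`, the source
of the bounds on `R` below. -/
lemma inv_mulVec_sq_le (hc : ∀ x, x ⬝ᵥ x ≤ x ⬝ᵥ M *ᵥ x) (x : Fin n → ℝ) :
    (M⁻¹ *ᵥ x) ⬝ᵥ (M⁻¹ *ᵥ x) ≤ x ⬝ᵥ M⁻¹ *ᵥ x := by
  have := hc (M⁻¹ *ᵥ x)
  rwa [mulVec_inv_mulVec hc, dotProduct_comm _ x] at this

lemma dotProduct_self_nonneg' (x : Fin n → ℝ) : 0 ≤ x ⬝ᵥ x :=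
  Finset.sum_nonneg fun _ _ => mul_self_nonneg _

lemma inv_quadForm_nonneg (hc : ∀ x, x ⬝ᵥ x ≤ x ⬝ᵥ M *ᵥ x) (x : Fin n → ℝ) :
    0 ≤ x ⬝ᵥ M⁻¹ *ᵥ x :=
  (dotProduct_self_nonneg' _).trans (inv_mulVec_sq_le hc x)

lemma inv_quadForm_le (hc : ∀ x, x ⬝ᵥ x ≤ x ⬝ᵥ M *ᵥ x) (x : Fin n → ℝ) :
    x ⬝ᵥ M⁻¹ *ᵥ x ≤ x ⬝ᵥ x := by
  have h1 := inv_mulVec_sq_le hc x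
  have h2 := dotProduct_self_nonneg' (x - M⁻¹ *ᵥ x)
  rw [sub_dotProduct, dotProduct_sub, dotProduct_sub, dotProduct_comm (M⁻¹ *ᵥ x) x] at h2
  linarith

lemma single_quadForm (R : Matrix (Fin n) (Fin n) ℝ) (i : Fin n) :
    (Pi.single i 1 : Fin n → ℝ) ⬝ᵥ R *ᵥ (Pi.single i 1) = R i i := by
  simp

lemma sum_sq_inv_le (hc : ∀ x, x ⬝ᵥ x ≤ x ⬝ᵥ M *ᵥ x) (i : Fin n) :
    ∑ j, M⁻¹ j i ^ 2 ≤ M⁻¹ i i := by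
  have := inv_mulVec_sq_le hc (Pi.single i 1)
  rw [single_quadForm] at this
  simpa [dotProduct, sq] using this

lemma inv_diag_nonneg (hc : ∀ x, x ⬝ᵥ x ≤ x ⬝ᵥ M *ᵥ x) (i : Fin n) : 0 ≤ M⁻¹ i i := by
  have := inv_quadForm_nonneg hc (Pi.single i 1)
  rwa [single_quadForm] at this

lemma inv_diag_le_one (hc : ∀ x, x ⬝ᵥ x ≤ x ⬝ᵥ M *ᵥ x) (i : Fin n) : M⁻¹ i i ≤ 1 := by
  have := inv_quadForm_le hc (Pi.single i 1)
  rw [single_quadForm] at this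
  simpa using this

lemma abs_inv_le_one (hc : ∀ x, x ⬝ᵥ x ≤ x ⬝ᵥ M *ᵥ x) (i j : Fin n) : |M⁻¹ i j| ≤ 1 := by
  rw [← sq_le_one_iff_abs_le_one]
  exact (Finset.single_le_sum (f := fun i => M⁻¹ i j ^ 2) (fun _ _ => sq_nonneg _)
    (Finset.mem_univ i)).trans ((sum_sq_inv_le hc j).trans (inv_diag_le_one hc j))

lemma inv_diag_pos (hc : ∀ x, x ⬝ᵥ x ≤ x ⬝ᵥ M *ᵥ x) (i : Fin n) : 0 < M⁻¹ i i := by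
  refine lt_of_le_of_ne (inv_diag_nonneg hc i) fun h => ?_
  have h1 := inv_mulVec_sq_le hc (Pi.single i 1)
  rw [single_quadForm, ← h] at h1
  have h2 := dotProduct_self_eq_zero.1 (le_antisymm h1 (dotProduct_self_nonneg' _))
  have h3 := mulVec_inv_mulVec hc (Pi.single i 1)
  rw [h2, Matrix.mulVec_zero] at h3
  have := congrFun h3 i
  simp at this

/-- Variational lower bound for the quadratic form of the inverse. -/
lemma two_mul_sub_le_inv_quadForm (hs : M.IsHermitian) (hc : ∀ x, x ⬝ᵥ x ≤ x ⬝ᵥ M *ᵥ x)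
    (x w : Fin n → ℝ) : 2 * (x ⬝ᵥ w) - w ⬝ᵥ M *ᵥ w ≤ x ⬝ᵥ M⁻¹ *ᵥ x := by
  -- Completing the square: the form of `M` is nonnegative at `M⁻¹x - w`.
  have h := (dotProduct_self_nonneg' _).trans (hc (M⁻¹ *ᵥ x - w))
  have hsym : (M⁻¹ *ᵥ x) ⬝ᵥ M *ᵥ w = x ⬝ᵥ w := by
    have ht : Mᵀ = M := by simpa using hs.eq
    rw [Matrix.dotProduct_mulVec, ← Matrix.mulVec_transpose, ht, mulVec_inv_mulVec hc]
  rw [Matrix.mulVec_sub, mulVec_inv_mulVec hc, sub_dotProduct, dotProduct_sub, dotProduct_sub,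
    hsym, dotProduct_comm _ x, dotProduct_comm w x] at h
  linarith

end Coercive

/-- The matrix obtained by replacing the `i`-th row and column by zero. -/
def zeroRow (A : Matrix (Fin n) (Fin n) ℝ) (i : Fin n) : Matrix (Fin n) (Fin n) ℝ :=
  Matrix.of fun j k => if j = i ∨ k = i then 0 else A j k

/-- The off-diagonal part of the `i`-th row. -/
def offDiagRow (A : Matrix (Fin n) (Fin n) ℝ) (i : Fin n) : Fin n → ℝ :=
  fun j => if j = i then 0 else A i j

variable {A : Matrix (Fin n) (Fin n) ℝ} {z : ℝ}

lemma zeroRow_isHermitian (hA : A.IsHermitian) (i : Fin n) : (zeroRow A i).IsHermitian := by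
  ext j k
  have := hA.apply j k
  simp only [star_trivial] at this
  simp [zeroRow, this, or_comm]

lemma zeroRow_quadForm (A : Matrix (Fin n) (Fin n) ℝ) (i : Fin n) (x : Fin n → ℝ) :
    x ⬝ᵥ zeroRow A i *ᵥ x = (Function.update x i 0) ⬝ᵥ A *ᵥ (Function.update x i 0) := by
  rw [quadForm_eq_sum, quadForm_eq_sum]
  refine Finset.sum_congr rfl fun j _ => Finset.sum_congr rfl fun k _ => ?_
  by_cases hj : j = i <;> by_cases hk : k = i <;> simp [zeroRow, hj, hk]

lemma opNorm_zeroRow_le (hA : A.IsHermitian) (i : Fin n) : opNorm (zeroRow A i) ≤ opNorm A := by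
  obtain ⟨u, hu, he⟩ := exists_abs_quadForm_eq_opNorm i.pos (zeroRow_isHermitian hA i)
  rw [← he, zeroRow_quadForm]
  refine (abs_quadForm_le A _).trans ?_
  have : (Function.update u i 0) ⬝ᵥ (Function.update u i 0) ≤ 1 := by
    rw [← hu]
    refine Finset.sum_le_sum fun j _ => ?_
    by_cases hj : j = i
    · subst hj; simpa using mul_self_nonneg (u j)
    · simp [hj]
  nlinarith [opNorm_nonneg A]

lemma coercive_of_opNorm_le (h : opNorm A ≤ z - 1) (x : Fin n → ℝ) :
    x ⬝ᵥ x ≤ x ⬝ᵥ (z • (1 : Matrix (Fin n) (Fin n) ℝ) - A) *ᵥ x := by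
  have h1 := (le_abs_self _).trans (abs_quadForm_le A x)
  have h2 := mul_le_mul_of_nonneg_right h (dotProduct_self_nonneg' x)
  rw [Matrix.sub_mulVec, Matrix.smul_mulVec, Matrix.one_mulVec, dotProduct_sub, dotProduct_smul,
    smul_eq_mul]
  linarith

lemma smul_one_sub_isHermitian (hA : A.IsHermitian) :
    (z • (1 : Matrix (Fin n) (Fin n) ℝ) - A).IsHermitian := by
  refine Matrix.IsHermitian.sub ?_ hA
  ext i j
  simp [Matrix.one_apply, eq_comm]

/-- Removing a row and a column lowers the trace of the resolvent by at most one. -/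
lemma trace_inv_sub_one_le (hA : A.IsHermitian) (hz : 0 < z) (h : opNorm A ≤ z - 1) (i : Fin n) :
    (z • (1 : Matrix (Fin n) (Fin n) ℝ) - A)⁻¹.trace - 1
      ≤ (z • (1 : Matrix (Fin n) (Fin n) ℝ) - zeroRow A i)⁻¹.trace
        - (z • (1 : Matrix (Fin n) (Fin n) ℝ) - zeroRow A i)⁻¹ i i := by
  set M := z • (1 : Matrix (Fin n) (Fin n) ℝ) - A with hM
  set N := z • (1 : Matrix (Fin n) (Fin n) ℝ) - zeroRow A i with hN
  have hc : ∀ x, x ⬝ᵥ x ≤ x ⬝ᵥ M *ᵥ x := coercive_of_opNorm_le h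
  set R := M⁻¹ with hR
  have hRi : 0 < R i i := inv_diag_pos hc i
  have hMR : M * R = 1 := Matrix.mul_nonsing_inv _ (isUnit_det_of_coercive hc)
  have hRs : ∀ j k, R j k = R k j := fun j k => by
    have h1 : Mᵀ = M := by
      rw [← Matrix.conjTranspose_eq_transpose_of_trivial]
      exact smul_one_sub_isHermitian hA
    have h2 : Rᵀ = R := by rw [hR, Matrix.transpose_nonsing_inv, h1]
    rw [← h2, Matrix.transpose_apply, h2]
  have hNM : ∀ j k, j ≠ i → k ≠ i → N j k = M j k := fun j k hj hk => by
    simp [hM, hN, zeroRow, hj, hk]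
  have hNi : ∀ k, N i k = if i = k then z else 0 := fun k => by
    simp [hN, zeroRow, Matrix.one_apply]
  have hNi' : ∀ j, j ≠ i → N j i = 0 := fun j hj => by
    simp [hN, zeroRow, hj]
  -- The explicit inverse of `N`: a rank-one correction of `R` that clears row and column `i`, plus
  -- `1/z` at position `(i,i)`.
  set S : Matrix (Fin n) (Fin n) ℝ := Matrix.of fun j k =>
    R j k - R j i * R i k / R i i + if j = i ∧ k = i then z⁻¹ else 0 with hS
  have hSi : ∀ k, S i k = if k = i then z⁻¹ else 0 := fun k => by
    simp only [hS, Matrix.of_apply, true_and]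
    rw [mul_div_cancel_left₀ _ hRi.ne', sub_self, zero_add]
  have hNS : N * S = 1 := by
    ext j l
    rw [Matrix.mul_apply]
    by_cases hj : j = i
    · subst hj
      simp only [hNi, ite_mul, zero_mul, Finset.sum_ite_eq, Finset.mem_univ, if_true, hSi,
        Matrix.one_apply]
      by_cases hl : l = j
      · simp [hl, hz.ne']
      · simp [hl, Ne.symm hl]
    · have e : ∀ k, N j k * S k l = M j k * R k l - M j k * R k i * (R i l / R i i) := by
        intro k
        by_cases hk : k = i
        · subst hk
          rw [hNi' j hj]
          field_simp
          ring
        · rw [hNM j k hj hk]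
          simp only [hS, Matrix.of_apply, hk, false_and, if_false]
          ring
      simp only [e, Finset.sum_sub_distrib, ← Finset.sum_mul]
      rw [← Matrix.mul_apply, ← Matrix.mul_apply, hMR, Matrix.one_apply_ne hj]
      ring
  rw [Matrix.inv_eq_right_inv hNS]
  -- The trace changes by `(R²)_ii / R_ii`, at most one because `(R²)_ii ≤ R_ii`.
  have hcol := sum_sq_inv_le hc i
  have htr : S.trace = R.trace - (∑ j, R j i ^ 2) / R i i + z⁻¹ := by
    have : ∀ j, S j j = R j j - R j i ^ 2 / R i i + if j = i then z⁻¹ else 0 := fun j => by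
      simp only [hS, Matrix.of_apply, and_self]
      rw [hRs i j, sq]
    simp only [Matrix.trace, Matrix.diag, this, Finset.sum_add_distrib, Finset.sum_sub_distrib,
      Finset.sum_div]
    simp
  have hdiv : (∑ j, R j i ^ 2) / R i i ≤ 1 := (div_le_one hRi).2 hcol
  rw [htr, hSi, if_pos rfl]
  linarith

/-- Lower bound for the diagonal entries of the resolvent in terms of the resolvent of the
matrix with one row removed. -/
lemma le_inv_diag (hA : A.IsHermitian) (hz : 0 < z) (h : opNorm A ≤ z - 1) (i : Fin n) (c : ℝ) :
    2 * c - c ^ 2 * (z - A i i - offDiagRow A i ⬝ᵥ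
        (z • (1 : Matrix (Fin n) (Fin n) ℝ) - zeroRow A i)⁻¹ *ᵥ offDiagRow A i)
      ≤ (z • (1 : Matrix (Fin n) (Fin n) ℝ) - A)⁻¹ i i := by
  set M := z • (1 : Matrix (Fin n) (Fin n) ℝ) - A with hM
  set N := z • (1 : Matrix (Fin n) (Fin n) ℝ) - zeroRow A i with hN
  set a := offDiagRow A i with ha
  have hc : ∀ x, x ⬝ᵥ x ≤ x ⬝ᵥ M *ᵥ x := coercive_of_opNorm_le h
  have hcN : ∀ x, x ⬝ᵥ x ≤ x ⬝ᵥ N *ᵥ x :=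
    coercive_of_opNorm_le ((opNorm_zeroRow_le hA i).trans h)
  have hsymm : ∀ j k, A j k = A k j := fun j k => by simpa using hA.apply k j
  set y := N⁻¹ *ᵥ a with hy
  have hNy : N *ᵥ y = a := mulVec_inv_mulVec hcN a
  have hai : a i = 0 := by simp [ha, offDiagRow]
  have hNrow : ∀ x : Fin n → ℝ, (N *ᵥ x) i = z * x i := fun x => by
    have : (zeroRow A i *ᵥ x) i = 0 := by simp [Matrix.mulVec, dotProduct, zeroRow]
    simp [hN, Matrix.sub_mulVec, Matrix.smul_mulVec, this]
  have hyi : y i = 0 := by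
    have := hNrow y
    rw [hNy, hai] at this
    exact (mul_eq_zero.1 this.symm).resolve_left hz.ne'
  -- The scalar is the Schur complement `s = 1/R_ii`. Testing the variational bound with a multiple
  -- `c` of this vector gives `2c - c²s`, affine in `s`, so expectations can be taken term by term.
  have hMv : M *ᵥ (Pi.single i 1 + y) = (z - A i i - a ⬝ᵥ y) • Pi.single i 1 := by
    ext j
    rw [Matrix.mulVec_add]
    by_cases hj : j = i
    · subst hj
      have : (A *ᵥ y) j = a ⬝ᵥ y := by
        simp only [Matrix.mulVec, dotProduct]
        refine Finset.sum_congr rfl fun k _ => ?_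
        by_cases hk : k = j
        · subst hk; simp [hyi]
        · simp [ha, offDiagRow, hk]
      simp [hM, Matrix.sub_mulVec, Matrix.smul_mulVec, hyi, this]
      ring
    · have h1 : (A *ᵥ y) j = (zeroRow A i *ᵥ y) j := by
        simp only [Matrix.mulVec, dotProduct]
        refine Finset.sum_congr rfl fun k _ => ?_
        by_cases hk : k = i
        · subst hk; simp [hyi]
        · simp [zeroRow, hj, hk]
      have h2 : (M *ᵥ y) j = a j := by
        rw [← hNy]
        simp only [hM, hN, Matrix.sub_mulVec, Pi.sub_apply, h1]
      have h3 : a j = A j i := by simp [ha, offDiagRow, hj, hsymm j i]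
      rw [Pi.add_apply, h2, h3]
      simp [hM, hj]
  have hv := two_mul_sub_le_inv_quadForm (smul_one_sub_isHermitian (z := z) hA) hc
    (Pi.single i 1) (c • (Pi.single i 1 + y))
  rw [Matrix.mulVec_smul, hMv, single_quadForm] at hv
  simp [hyi] at hv
  simp only [dotProduct_comm a y] at hv ⊢
  nlinarith [hv]

lemma dotProduct_offDiagRow_le (h : ∀ i j, |A i j| ≤ 1) (i : Fin n) :
    offDiagRow A i ⬝ᵥ offDiagRow A i ≤ n := by
  have : ∀ j ∈ Finset.univ, offDiagRow A i j * offDiagRow A i j ≤ 1 := fun j _ => by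
    rw [← sq, sq_le_one_iff_abs_le_one]
    unfold offDiagRow
    split_ifs
    · simp
    · exact h i j
  simpa [dotProduct] using Finset.sum_le_card_nsmul _ _ _ this

end Resolvent

/-! ### The self-consistent inequality for the expected trace of the resolvent -/

section TruncResolvent

variable {n : ℕ} {z : ℝ}

open scoped Classical in
/-- The resolvent of `B` at `z`, set to zero unless `opNorm B ≤ z - 1`. -/
noncomputable def truncResolvent (z : ℝ) (B : Matrix (Fin n) (Fin n) ℝ) :
    Matrix (Fin n) (Fin n) ℝ :=
  if opNorm B ≤ z - 1 then (z • (1 : Matrix (Fin n) (Fin n) ℝ) - B)⁻¹ else 0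

lemma truncResolvent_of_le {B : Matrix (Fin n) (Fin n) ℝ} (h : opNorm B ≤ z - 1) :
    truncResolvent z B = (z • (1 : Matrix (Fin n) (Fin n) ℝ) - B)⁻¹ := if_pos h

lemma truncResolvent_of_lt {B : Matrix (Fin n) (Fin n) ℝ} (h : ¬ opNorm B ≤ z - 1) :
    truncResolvent z B = 0 := if_neg h

lemma abs_truncResolvent_le (B : Matrix (Fin n) (Fin n) ℝ) (i j : Fin n) :
    |truncResolvent z B i j| ≤ 1 := by
  by_cases h : opNorm B ≤ z - 1
  · rw [truncResolvent_of_le h]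
    exact abs_inv_le_one (coercive_of_opNorm_le h) i j
  · simp [truncResolvent_of_lt h]

lemma truncResolvent_diag_nonneg (B : Matrix (Fin n) (Fin n) ℝ) (i : Fin n) :
    0 ≤ truncResolvent z B i i := by
  by_cases h : opNorm B ≤ z - 1
  · rw [truncResolvent_of_le h]
    exact inv_diag_nonneg (coercive_of_opNorm_le h) i
  · simp [truncResolvent_of_lt h]

lemma truncResolvent_quadForm_le (B : Matrix (Fin n) (Fin n) ℝ) (x : Fin n → ℝ) :
    x ⬝ᵥ truncResolvent z B *ᵥ x ≤ x ⬝ᵥ x := by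
  by_cases h : opNorm B ≤ z - 1
  · rw [truncResolvent_of_le h]
    exact inv_quadForm_le (coercive_of_opNorm_le h) x
  · simpa [truncResolvent_of_lt h] using dotProduct_self_nonneg' x

lemma measurable_inv_apply {Ω : Type*} [MeasurableSpace Ω] {B : Ω → Matrix (Fin n) (Fin n) ℝ}
    (hB : ∀ i j, Measurable fun ω => B ω i j) (i j : Fin n) :
    Measurable fun ω => (B ω)⁻¹ i j := by
  have h1 : Measurable fun ω => fun i j => B ω i j :=
    measurable_pi_iff.2 fun i => measurable_pi_iff.2 fun j => hB i j
  have hid : Continuous fun M : Fin n → Fin n → ℝ => (Matrix.of M : Matrix (Fin n) (Fin n) ℝ) :=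
    continuous_id
  have h2 : Continuous fun M : Fin n → Fin n → ℝ => (Matrix.of M).det := hid.matrix_det
  have h3 : Continuous fun M : Fin n → Fin n → ℝ => (Matrix.of M).adjugate i j :=
    hid.matrix_adjugate.matrix_elem i j
  have h4 : ∀ ω, (B ω)⁻¹ i j = ((B ω).det)⁻¹ * (B ω).adjugate i j := fun ω => by
    rw [Matrix.inv_def, Ring.inverse_eq_inv', Matrix.smul_apply, smul_eq_mul]
  simp only [h4]
  exact (h2.measurable.comp h1).inv.mul (h3.measurable.comp h1)

lemma measurable_truncResolvent_apply {Ω : Type*} [MeasurableSpace Ω]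
    {B : Ω → Matrix (Fin n) (Fin n) ℝ} (hB : ∀ i j, Measurable fun ω => B ω i j) (i j : Fin n) :
    Measurable fun ω => truncResolvent z (B ω) i j := by
  classical
  have h : ∀ ω, truncResolvent z (B ω) i j = if opNorm (B ω) ≤ z - 1 then
      (z • (1 : Matrix (Fin n) (Fin n) ℝ) - B ω)⁻¹ i j else 0 := fun ω => by
    unfold truncResolvent
    split_ifs <;> rfl
  simp only [h]
  refine Measurable.ite (measurableSet_le (measurable_opNorm_comp hB) measurable_const)
    (measurable_inv_apply (fun k l => ?_) i j) measurable_const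
  simp only [Matrix.sub_apply]
  exact measurable_const.sub (hB k l)

lemma measurable_zeroRow_apply {Ω : Type*} [MeasurableSpace Ω]
    {B : Ω → Matrix (Fin n) (Fin n) ℝ} (hB : ∀ i j, Measurable fun ω => B ω i j)
    (i j k : Fin n) : Measurable fun ω => zeroRow (B ω) i j k := by
  simp only [zeroRow, Matrix.of_apply]
  split_ifs
  · exact measurable_const
  · exact hB j k

/-- On the bad event the left side is `-1`, while the right side is a sum of nonnegative diagonal
entries. -/
lemma trace_truncResolvent_sub_one_le {A : Matrix (Fin n) (Fin n) ℝ} (hA : A.IsHermitian)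
    (hz : 0 < z) (i : Fin n) :
    (truncResolvent z A).trace - 1 ≤ (truncResolvent z (zeroRow A i)).trace
      - truncResolvent z (zeroRow A i) i i := by
  by_cases h : opNorm A ≤ z - 1
  · rw [truncResolvent_of_le h, truncResolvent_of_le ((opNorm_zeroRow_le hA i).trans h)]
    exact trace_inv_sub_one_le hA hz h i
  · rw [truncResolvent_of_lt h]
    have : truncResolvent z (zeroRow A i) i i ≤ (truncResolvent z (zeroRow A i)).trace :=
      Finset.single_le_sum (f := fun j => truncResolvent z (zeroRow A i) j j)
        (fun j _ => truncResolvent_diag_nonneg _ j) (Finset.mem_univ i)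
    simp only [Matrix.trace_zero]
    linarith

open scoped Classical in
-- When `A` is truncated, the matrix without row `i` need not be, so the quadratic form may be as
-- large as `n`; the term with `n` times the indicator pays for this. The `+ 1` absorbs the diagonal
-- entry.
lemma le_truncResolvent_diag {A : Matrix (Fin n) (Fin n) ℝ} (hA : A.IsHermitian)
    (h1 : ∀ i j, |A i j| ≤ 1) (hz : 0 < z) (i : Fin n) (c : ℝ) :
    2 * c * (1 - if z - 1 < opNorm A then 1 else 0)
      - c ^ 2 * (z + 1 - offDiagRow A i ⬝ᵥ truncResolvent z (zeroRow A i) *ᵥ offDiagRow A i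
        + n * if z - 1 < opNorm A then 1 else 0) ≤ truncResolvent z A i i := by
  by_cases h : opNorm A ≤ z - 1
  · rw [if_neg (not_lt.2 h), truncResolvent_of_le h,
      truncResolvent_of_le ((opNorm_zeroRow_le hA i).trans h)]
    have hl := le_inv_diag hA hz h i c
    have := (abs_le.1 (h1 i i)).1
    nlinarith [mul_nonneg (sq_nonneg c) (by linarith : 0 ≤ 1 + A i i)]
  · rw [if_pos (not_le.1 h), truncResolvent_of_lt h, Matrix.zero_apply]
    have hq := (truncResolvent_quadForm_le (z := z) (zeroRow A i) (offDiagRow A i)).trans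
      (dotProduct_offDiagRow_le h1 i)
    nlinarith [mul_nonneg (sq_nonneg c) (by linarith : 0 ≤ z + 1 - offDiagRow A i ⬝ᵥ
      truncResolvent z (zeroRow A i) *ᵥ offDiagRow A i + n * 1)]

end TruncResolvent

section Expectation

variable {n : ℕ} {Ω : Type*} [MeasurableSpace Ω] {μ : Measure Ω} {z σ : ℝ}
  {A : Ω → Matrix (Fin n) (Fin n) ℝ}

lemma IsRandomSymmetric.apply_eq (hA : IsRandomSymmetric μ A) (ω : Ω) (i j : Fin n) :
    A ω (min i j) (max i j) = A ω i j := by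
  rcases le_total i j with hij | hij
  · rw [min_eq_left hij, max_eq_right hij]
  · rw [min_eq_right hij, max_eq_left hij]
    simpa using (hA.isHermitian ω).apply i j

/-- The unordered pair of two indices, as an index on or above the diagonal. -/
def upperPair (i j : Fin n) : {p : Fin n × Fin n // p.1 ≤ p.2} :=
  ⟨(min i j, max i j), min_le_max⟩

/-- The products of two entries of the `i`-th row are independent of the rest of the matrix. -/
lemma IsRandomSymmetric.indepFun_mul_truncResolvent (hA : IsRandomSymmetric μ A) (z : ℝ)
    (i j k l m : Fin n) :
    IndepFun (fun ω => A ω i j * A ω i k)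
      (fun ω => truncResolvent z (zeroRow (A ω) i) l m) μ := by
  classical
  -- `S` holds the pairs containing `i`: row `i` depends on `S` alone and `zeroRow` on its
  -- complement.
  set S : Finset {p : Fin n × Fin n // p.1 ≤ p.2} :=
    Finset.univ.filter fun p => p.1.1 = i ∨ p.1.2 = i with hS
  have hind := hA.indep.indepFun_finset S Sᶜ disjoint_compl_right
    (fun p => hA.measurable_entry _ _)
  have hmem : ∀ j, upperPair i j ∈ S := fun j => by
    rcases le_total i j with hij | hij <;> simp [hS, upperPair, hij]
  have hnot : ∀ j k, j ≠ i → k ≠ i → upperPair j k ∈ Sᶜ := fun j k hj hk => by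
    rcases le_total j k with hjk | hjk <;> simp [hS, upperPair, hjk, hj, hk]
  let φ : (S → ℝ) → ℝ := fun x => x ⟨upperPair i j, hmem j⟩ * x ⟨upperPair i k, hmem k⟩
  let B : ((Sᶜ : Finset {p : Fin n × Fin n // p.1 ≤ p.2}) → ℝ) → Matrix (Fin n) (Fin n) ℝ :=
    fun x => Matrix.of fun j k =>
      if h : j ≠ i ∧ k ≠ i then x ⟨upperPair j k, hnot j k h.1 h.2⟩ else 0
  have hφ : Measurable φ := by fun_prop
  have hB : ∀ j k, Measurable fun x => B x j k := fun j k => by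
    simp only [B, Matrix.of_apply]
    split_ifs <;> fun_prop
  have h := hind.comp hφ (measurable_truncResolvent_apply (z := z) hB l m)
  have e1 : (φ ∘ fun ω (p : S) => A ω p.1.1.1 p.1.1.2) = fun ω => A ω i j * A ω i k := by
    ext ω
    simp [φ, upperPair, hA.apply_eq]
  have e2 : ((fun x => truncResolvent z (B x) l m) ∘
      fun ω (p : (Sᶜ : Finset {p : Fin n × Fin n // p.1 ≤ p.2})) => A ω p.1.1.1 p.1.1.2)
      = fun ω => truncResolvent z (zeroRow (A ω) i) l m := by
    ext ω
    have : B (fun p => A ω p.1.1.1 p.1.1.2) = zeroRow (A ω) i := by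
      ext j k
      simp only [B, zeroRow, Matrix.of_apply, upperPair, hA.apply_eq]
      by_cases hj : j = i <;> by_cases hk : k = i <;> simp [hj, hk]
    simp only [Function.comp_apply, this]
  rw [e1, e2] at h
  exact h

lemma IsRandomSymmetric.integral_mul_eq (hA : IsRandomSymmetric μ A)
    (h0 : ∀ i j, ∫ ω, A ω i j ∂μ = 0)
    (hvar : ∀ i j, variance (fun ω => A ω i j) μ = σ ^ 2) (i j k : Fin n) :
    ∫ ω, A ω i j * A ω i k ∂μ = if j = k then σ ^ 2 else 0 := by
  split_ifs with h
  · subst h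
    rw [← hvar i j, variance_of_integral_eq_zero (hA.measurable_entry i j).aemeasurable (h0 i j)]
    simp [sq]
  · have hne : upperPair i j ≠ upperPair i k := by
      intro he
      have h1 : min i j = min i k := congrArg (fun p => p.1.1) he
      have h2 : max i j = max i k := congrArg (fun p => p.1.2) he
      grind
    have hi := hA.indep.indepFun hne
    simp only [upperPair, hA.apply_eq] at hi
    rw [hi.integral_fun_mul_eq_mul_integral (hA.measurable_entry i j).aestronglyMeasurable
      (hA.measurable_entry i k).aestronglyMeasurable, h0, zero_mul]

variable [IsProbabilityMeasure μ]

lemma integrable_truncResolvent_apply {B : Ω → Matrix (Fin n) (Fin n) ℝ}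
    (hB : ∀ i j, Measurable fun ω => B ω i j) (i j : Fin n) :
    Integrable (fun ω => truncResolvent z (B ω) i j) μ :=
  integrable_of_abs_le (measurable_truncResolvent_apply hB i j) fun _ =>
    abs_truncResolvent_le _ i j

lemma IsRandomSymmetric.integrable_mul (hA : IsRandomSymmetric μ A) (i j k : Fin n) :
    Integrable (fun ω => A ω i j * A ω i k) μ :=
  Integrable.of_bound ((hA.measurable_entry i j).mul (hA.measurable_entry i k)).aestronglyMeasurable
    1 (by
      filter_upwards [hA.ae_abs_le] with ω h
      rw [Real.norm_eq_abs, abs_mul]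
      exact mul_le_one₀ (h i j) (abs_nonneg _) (h i k))

lemma offDiagRow_quadForm_eq (M B : Matrix (Fin n) (Fin n) ℝ) (i : Fin n) :
    offDiagRow M i ⬝ᵥ B *ᵥ offDiagRow M i
      = ∑ j, ∑ k, if j = i ∨ k = i then 0 else M i j * M i k * B j k := by
  rw [quadForm_eq_sum]
  refine Finset.sum_congr rfl fun j _ => Finset.sum_congr rfl fun k _ => ?_
  by_cases hj : j = i <;> by_cases hk : k = i <;> simp [offDiagRow, hj, hk, mul_comm]

lemma IsRandomSymmetric.integrable_quadForm_term (hA : IsRandomSymmetric μ A) (i j k : Fin n) :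
    Integrable (fun ω => if j = i ∨ k = i then 0 else
      A ω i j * A ω i k * truncResolvent z (zeroRow (A ω) i) j k) μ := by
  split_ifs
  · exact integrable_zero _ _ _
  · exact (hA.indepFun_mul_truncResolvent z i j k j k).integrable_mul (hA.integrable_mul i j k)
      (integrable_truncResolvent_apply (measurable_zeroRow_apply hA.measurable_entry i) j k)

lemma IsRandomSymmetric.integrable_quadForm (hA : IsRandomSymmetric μ A) (i : Fin n) :
    Integrable (fun ω => offDiagRow (A ω) i ⬝ᵥ truncResolvent z (zeroRow (A ω) i) *ᵥ
      offDiagRow (A ω) i) μ := by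
  simp only [offDiagRow_quadForm_eq]
  exact integrable_finsetSum _ fun j _ => integrable_finsetSum _ fun k _ =>
    hA.integrable_quadForm_term i j k

/-- The row is independent of the remaining resolvent and its entries are uncorrelated, so only the
terms `j = k ≠ i` survive. -/
lemma IsRandomSymmetric.integral_quadForm (hA : IsRandomSymmetric μ A)
    (h0 : ∀ i j, ∫ ω, A ω i j ∂μ = 0)
    (hvar : ∀ i j, variance (fun ω => A ω i j) μ = σ ^ 2) (i : Fin n) :
    ∫ ω, offDiagRow (A ω) i ⬝ᵥ truncResolvent z (zeroRow (A ω) i) *ᵥ offDiagRow (A ω) i ∂μ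
      = σ ^ 2 * ∫ ω, ((truncResolvent z (zeroRow (A ω) i)).trace
        - truncResolvent z (zeroRow (A ω) i) i i) ∂μ := by
  have hm := measurable_zeroRow_apply hA.measurable_entry i
  have hterm : ∀ j k, ∫ ω, (if j = i ∨ k = i then 0 else
      A ω i j * A ω i k * truncResolvent z (zeroRow (A ω) i) j k) ∂μ
      = if j = k then (if j = i then 0 else
        σ ^ 2 * ∫ ω, truncResolvent z (zeroRow (A ω) i) j j ∂μ) else 0 := by
    intro j k
    by_cases h : j = i ∨ k = i
    · simp only [h, if_true, integral_zero]
      grind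
    · simp only [h, if_false]
      rw [(hA.indepFun_mul_truncResolvent z i j k j k).integral_fun_mul_eq_mul_integral
        (hA.integrable_mul i j k).aestronglyMeasurable
        (measurable_truncResolvent_apply hm j k).aestronglyMeasurable,
        hA.integral_mul_eq h0 hvar]
      rw [not_or] at h
      by_cases hjk : j = k
      · subst hjk; simp [h.1]
      · simp [hjk]
  simp only [offDiagRow_quadForm_eq]
  rw [integral_finsetSum _ fun j _ => integrable_finsetSum _ fun k _ =>
    hA.integrable_quadForm_term i j k]
  simp only [integral_finsetSum _ fun k _ => hA.integrable_quadForm_term i _ k, hterm]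
  simp only [Matrix.trace, Matrix.diag]
  rw [integral_sub (integrable_finsetSum _ fun j _ => integrable_truncResolvent_apply hm j j)
    (integrable_truncResolvent_apply hm i i),
    integral_finsetSum _ fun j _ => integrable_truncResolvent_apply hm j j, mul_sub,
    Finset.mul_sum, ← Finset.sum_erase_eq_sub (Finset.mem_univ i)]
  simp only [Finset.sum_ite_eq, Finset.mem_univ, if_true]
  rw [← Finset.sum_erase _ (a := i) (by simp)]
  exact Finset.sum_congr rfl fun j hj => if_neg (Finset.ne_of_mem_erase hj)

/-- The self-consistent equation for the resolvent trace has no solution when `z` is well below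
`2 σ √n`. -/
theorem IsRandomSymmetric.two_mul_sigma_sqrt_le (hn : 0 < n) (hA : IsRandomSymmetric μ A)
    (h0 : ∀ i j, ∫ ω, A ω i j ∂μ = 0)
    (hvar : ∀ i j, variance (fun ω => A ω i j) μ = σ ^ 2) (hσ : 0 < σ) (hz : 0 < z) :
    2 * σ * √n * (1 - μ.real {ω | z - 1 < opNorm (A ω)})
      ≤ z + 1 + σ ^ 2 + n * μ.real {ω | z - 1 < opNorm (A ω)} := by
  classical
  set p := μ.real {ω | z - 1 < opNorm (A ω)} with hp
  have hn' : (0 : ℝ) < n := by exact_mod_cast hn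
  have hsn : 0 < √(n : ℝ) := Real.sqrt_pos.2 hn'
  -- With this value `c²nσ² = 1`, so `T` has the same coefficient on both sides of `hfin` and
  -- cancels; no estimate of `T` is needed.
  set c : ℝ := 1 / (σ * √n) with hc
  have hms : MeasurableSet {ω | z - 1 < opNorm (A ω)} :=
    measurableSet_lt measurable_const hA.measurable_opNorm
  set χ : Ω → ℝ := fun ω => if z - 1 < opNorm (A ω) then 1 else 0 with hχ
  have hχi : χ = Set.indicator {ω | z - 1 < opNorm (A ω)} fun _ => (1 : ℝ) := by
    ext ω; simp [hχ, Set.indicator_apply]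
  have hχint : Integrable χ μ := by
    rw [hχi]; exact (integrable_const _).indicator hms
  have hχp : ∫ ω, χ ω ∂μ = p := by
    rw [hχi, integral_indicator_const _ hms]; simp [hp]
  have hRi := fun i => integrable_truncResolvent_apply (μ := μ) (z := z) hA.measurable_entry i i
  set T := ∫ ω, (truncResolvent z (A ω)).trace ∂μ with hT
  have hTi : Integrable (fun ω => (truncResolvent z (A ω)).trace) μ :=
    integrable_finsetSum _ fun i _ => hRi i
  have hq : ∀ i, σ ^ 2 * (T - 1) ≤ ∫ ω, offDiagRow (A ω) i ⬝ᵥ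
      truncResolvent z (zeroRow (A ω) i) *ᵥ offDiagRow (A ω) i ∂μ := by
    intro i
    have hm := measurable_zeroRow_apply hA.measurable_entry i
    rw [hA.integral_quadForm h0 hvar i]
    refine mul_le_mul_of_nonneg_left ?_ (sq_nonneg σ)
    have : T - 1 = ∫ ω, ((truncResolvent z (A ω)).trace - 1) ∂μ := by
      rw [integral_sub hTi (integrable_const _)]; simp [hT]
    rw [this]
    refine integral_mono (hTi.sub (integrable_const _)) ?_ fun ω =>
      trace_truncResolvent_sub_one_le (hA.isHermitian ω) hz i
    exact (integrable_finsetSum _ fun j _ => integrable_truncResolvent_apply hm j j).sub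
      (integrable_truncResolvent_apply hm i i)
  have hdiag : ∀ i, 2 * c * (1 - p) - c ^ 2 * (z + 1 - σ ^ 2 * (T - 1) + n * p)
      ≤ ∫ ω, truncResolvent z (A ω) i i ∂μ := by
    intro i
    have hQ := hA.integrable_quadForm (z := z) i
    have j1 : Integrable (fun ω => 2 * c * (1 - χ ω)) μ :=
      ((integrable_const _).sub hχint).const_mul _
    have j2' : Integrable (fun ω => z + 1 - offDiagRow (A ω) i ⬝ᵥ
        truncResolvent z (zeroRow (A ω) i) *ᵥ offDiagRow (A ω) i) μ :=
      (integrable_const _).sub hQ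
    have j2 : Integrable (fun ω => c ^ 2 * (z + 1 - offDiagRow (A ω) i ⬝ᵥ
        truncResolvent z (zeroRow (A ω) i) *ᵥ offDiagRow (A ω) i + n * χ ω)) μ :=
      (j2'.add (hχint.const_mul _)).const_mul _
    have h := integral_mono_ae (j1.sub j2) (hRi i) (by
      filter_upwards [hA.ae_abs_le] with ω h
      exact le_truncResolvent_diag (hA.isHermitian ω) h hz i c)
    simp only [Pi.sub_apply] at h
    rw [integral_sub j1 j2, integral_const_mul, integral_const_mul,
      integral_sub (integrable_const _) hχint, integral_add j2' (hχint.const_mul _),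
      integral_sub (integrable_const _) hQ, integral_const_mul, hχp] at h
    simp only [integral_const, probReal_univ, one_smul] at h
    nlinarith [mul_le_mul_of_nonneg_left (hq i) (sq_nonneg c)]
  have hsum : T = ∑ i, ∫ ω, truncResolvent z (A ω) i i ∂μ :=
    integral_finsetSum _ fun i _ => hRi i
  have hfin : n * (2 * c * (1 - p) - c ^ 2 * (z + 1 - σ ^ 2 * (T - 1) + n * p)) ≤ T := by
    have := Finset.card_nsmul_le_sum Finset.univ _ _ fun i _ => hdiag i
    simpa [← hsum] using this
  have hcn : c ^ 2 * n * σ ^ 2 = 1 := by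
    rw [hc, div_pow, mul_pow, Real.sq_sqrt hn'.le]
    field_simp
  have hcn' : n * c * σ ^ 2 = σ * √n := by
    have : (n : ℝ) = √n * √n := (Real.mul_self_sqrt hn'.le).symm
    rw [hc]
    field_simp
    rw [Real.sq_sqrt hn'.le]
  have h2 := mul_le_mul_of_nonneg_right hfin (sq_nonneg σ)
  have e : n * (2 * c * (1 - p) - c ^ 2 * (z + 1 - σ ^ 2 * (T - 1) + n * p)) * σ ^ 2
      = 2 * (n * c * σ ^ 2) * (1 - p)
        - (c ^ 2 * n * σ ^ 2) * (z + 1 - σ ^ 2 * (T - 1) + n * p) := by ring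
  rw [e, hcn, hcn'] at h2
  linarith

end Expectation

/-! ### The lower bound for the expectation and in probability -/

section Main

variable {n : ℕ} {Ω : Type*} [MeasurableSpace Ω] {μ : Measure Ω} [IsProbabilityMeasure μ]
  {σ : ℝ} {A : Ω → Matrix (Fin n) (Fin n) ℝ}

lemma IsRandomSymmetric.sigma_sq_le_one (hn : 0 < n) (hA : IsRandomSymmetric μ A)
    (h0 : ∀ i j, ∫ ω, A ω i j ∂μ = 0)
    (hvar : ∀ i j, variance (fun ω => A ω i j) μ = σ ^ 2) : σ ^ 2 ≤ 1 := by
  have h := hA.integral_mul_eq h0 hvar ⟨0, hn⟩ ⟨0, hn⟩ ⟨0, hn⟩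
  rw [if_pos rfl] at h
  rw [← h]
  refine (integral_mono_ae (hA.integrable_mul _ _ _) (integrable_const 1) ?_).trans (by simp)
  filter_upwards [hA.ae_abs_le] with ω hω
  have := hω ⟨0, hn⟩ ⟨0, hn⟩
  rw [← sq]
  rwa [sq_le_one_iff_abs_le_one]

/-- Lets a multiple of `√(log n)` absorb additive constants. -/
lemma four_fifths_le_sqrt_log (hn : 2 ≤ n) : 4 / 5 ≤ √(Real.log n) := by
  apply Real.le_sqrt_of_sq_le
  have h1 : Real.log 2 ≤ Real.log n := Real.log_le_log (by norm_num) (by exact_mod_cast hn)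
  have := Real.log_two_gt_d9
  norm_num at this ⊢
  linarith

theorem IsRandomSymmetric.le_integral_opNorm (hn : 2 ≤ n) (hA : IsRandomSymmetric μ A)
    (h0 : ∀ i j, ∫ ω, A ω i j ∂μ = 0)
    (hvar : ∀ i j, variance (fun ω => A ω i j) μ = σ ^ 2) (hσ : 0 ≤ σ) :
    2 * σ * √n - 16 * √(Real.log n) ≤ ∫ ω, opNorm (A ω) ∂μ := by
  have hE : 0 ≤ ∫ ω, opNorm (A ω) ∂μ := integral_nonneg fun ω => opNorm_nonneg _
  have hn0 : 0 < n := by omega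
  have hn1 : (1 : ℝ) ≤ n := by exact_mod_cast (by omega : 1 ≤ n)
  have hL := four_fifths_le_sqrt_log hn
  rcases hσ.eq_or_lt with rfl | hσ
  · linarith
  set L := √(Real.log n) with hLdef
  set E := ∫ ω, opNorm (A ω) ∂μ with hEdef
  have hσ1 := hA.sigma_sq_le_one hn0 h0 hvar
  have hσ1' : σ ≤ 1 := by nlinarith
  -- The bad event is now `‖A‖ > E + 8L`, of probability at most `exp(-64 log n / 64) = 1/n`, which
  -- just offsets the factor `n` in the error term.
  have key := hA.two_mul_sigma_sqrt_le (z := E + 8 * L + 1) hn0 h0 hvar hσ (by linarith)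
  have hp : μ.real {ω | E + 8 * L + 1 - 1 < opNorm (A ω)} ≤ (n : ℝ)⁻¹ := by
    have ht := hA.measureReal_opNorm_ge_le hn0 (t := 8 * L) (by linarith)
    have e : Real.exp (-(8 * L) ^ 2 / 64) = (n : ℝ)⁻¹ := by
      have : (8 * L) ^ 2 = 64 * Real.log n := by
        rw [mul_pow, hLdef, Real.sq_sqrt (Real.log_nonneg hn1)]; norm_num
      rw [this, show -(64 * Real.log n) / 64 = -Real.log n by ring, Real.exp_neg,
        Real.exp_log (by linarith)]
    rw [e] at ht
    refine (measureReal_mono fun ω hω => ?_).trans ht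
    simp only [Set.mem_ofPred_eq, add_sub_cancel_right] at hω ⊢
    exact hω.le
  set p := μ.real {ω | E + 8 * L + 1 - 1 < opNorm (A ω)} with hpdef
  have hp0 : 0 ≤ p := measureReal_nonneg
  have hnp : n * p ≤ 1 := by
    have := mul_le_mul_of_nonneg_left hp (by linarith : (0 : ℝ) ≤ n)
    rwa [mul_inv_cancel₀ (by linarith)] at this
  have hs : √(n : ℝ) ≤ n := Real.sqrt_le_iff.2 ⟨by linarith, by nlinarith⟩
  have hsp : σ * (√n * p) ≤ 1 := by
    have h1 : √(n : ℝ) * p ≤ 1 := (mul_le_mul_of_nonneg_right hs hp0).trans hnp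
    have h2 : 0 ≤ √(n : ℝ) * p := by positivity
    nlinarith
  -- The errors add up to `2σ√n ≤ E + 8L + 6`, and `6 ≤ 8L` because `L ≥ 4/5`.
  nlinarith

/-- A lower tail bound for the operator norm, by Markov's inequality. -/
lemma IsRandomSymmetric.measureReal_opNorm_le_sub_le (hn : 0 < n) (hA : IsRandomSymmetric μ A)
    {t : ℝ} (ht : 0 < t) :
    μ.real {ω | opNorm (A ω) ≤ (∫ ω, opNorm (A ω) ∂μ) - t} ≤ Real.exp 16 / t := by
  set E := ∫ ω, opNorm (A ω) ∂μ with hE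
  have hI := hA.integrable_opNorm hn
  have hYi : Integrable (fun ω => E - opNorm (A ω)) μ := (integrable_const _).sub hI
  have hexpi : Integrable (fun ω => Real.exp (opNorm (A ω) - E)) μ := by
    simp only [sub_eq_add_neg, Real.exp_add]
    have := (hA.integrable_exp_opNorm hn zero_le_one).mul_const (Real.exp (-E))
    simpa using this
  have hexp : ∫ ω, Real.exp (opNorm (A ω) - E) ∂μ ≤ Real.exp 16 := by
    have h := hA.mgf_opNorm_le hn zero_le_one
    simp only [one_mul, one_pow, mul_one] at h
    simp only [sub_eq_add_neg, Real.exp_add, integral_mul_const]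
    rw [Real.exp_add, ← hE] at h
    have := mul_le_mul_of_nonneg_right h (Real.exp_pos (-E)).le
    rw [mul_right_comm, ← Real.exp_add, add_neg_cancel, Real.exp_zero, one_mul] at this
    exact this
  have hneg : ∫ ω, max (E - opNorm (A ω)) 0 ∂μ ≤ Real.exp 16 := by
    -- The linear term has mean zero, so only the exponential moment at `s = 1` contributes.
    have hpt : ∀ ω, max (E - opNorm (A ω)) 0
        ≤ (E - opNorm (A ω)) + Real.exp (opNorm (A ω) - E) := fun ω => by
      have h1 := Real.add_one_le_exp (opNorm (A ω) - E)
      have h2 := Real.exp_pos (opNorm (A ω) - E)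
      exact max_le (by linarith) (by linarith)
    refine (integral_mono hYi.pos_part (hYi.add hexpi) hpt).trans ?_
    simp only [Pi.add_apply]
    rw [integral_add hYi hexpi, integral_sub (integrable_const _) hI]
    simpa [hE] using hexp
  rw [le_div_iff₀ ht, mul_comm]
  refine le_trans ?_ ((mul_meas_ge_le_integral_of_nonneg (ae_of_all _ fun ω => le_max_right _ _)
    hYi.pos_part t).trans hneg)
  refine mul_le_mul_of_nonneg_left (measureReal_mono fun ω hω => ?_) ht.le
  simp only [Set.mem_ofPred_eq] at hω ⊢
  exact le_max_of_le_left (by linarith)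

theorem IsRandomSymmetric.one_sub_le_measureReal (hn : 2 ≤ n) (hA : IsRandomSymmetric μ A)
    (h0 : ∀ i j, ∫ ω, A ω i j ∂μ = 0)
    (hvar : ∀ i j, variance (fun ω => A ω i j) μ = σ ^ 2) (hσ : 0 ≤ σ) :
    1 - Real.exp 16 / √(Real.log n)
      ≤ μ.real {ω | 2 * σ * √n - 17 * √(Real.log n) ≤ opNorm (A ω)} := by
  have hL := four_fifths_le_sqrt_log hn
  have hE := hA.le_integral_opNorm hn h0 hvar hσ
  have h := hA.measureReal_opNorm_le_sub_le (by omega) (t := √(Real.log n)) (by linarith)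
  have hms : MeasurableSet {ω | 2 * σ * √n - 17 * √(Real.log n) ≤ opNorm (A ω)} :=
    measurableSet_le measurable_const hA.measurable_opNorm
  have hc := probReal_compl_eq_one_sub (μ := μ) hms
  have hle : μ.real {ω | 2 * σ * √n - 17 * √(Real.log n) ≤ opNorm (A ω)}ᶜ
      ≤ Real.exp 16 / √(Real.log n) := by
    refine (measureReal_mono fun ω hω => ?_).trans h
    simp only [Set.mem_compl_iff, Set.mem_ofPred_eq, not_le] at hω ⊢
    linarith
  linarith

end Main

theorem corollary2 :
    ∃ C : ℝ,
      (∀ n : ℕ, 2 ≤ n →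
        ∀ (Ω : Type*) [MeasurableSpace Ω] (μ : Measure Ω) [IsProbabilityMeasure μ]
          (A : Ω → Matrix (Fin n) (Fin n) ℝ) (hA : IsRandomSymmetric μ A)
          (σ : ℝ), 0 ≤ σ →
          (∀ i j, ∫ ω, A ω i j ∂μ = 0) →
          (∀ i j, variance (fun ω => A ω i j) μ = σ ^ 2) →
          Integrable (fun ω => lambda1 (hA.isHermitian ω)) μ ∧
          2 * σ * Real.sqrt n - C * Real.sqrt (Real.log n)
            ≤ ∫ ω, lambda1 (hA.isHermitian ω) ∂μ) ∧
      (∀ ε : ℝ, 0 < ε → ∃ N : ℕ, ∀ n : ℕ, N ≤ n →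
        ∀ (Ω : Type*) [MeasurableSpace Ω] (μ : Measure Ω) [IsProbabilityMeasure μ]
          (A : Ω → Matrix (Fin n) (Fin n) ℝ) (hA : IsRandomSymmetric μ A)
          (σ : ℝ), 0 ≤ σ →
          (∀ i j, ∫ ω, A ω i j ∂μ = 0) →
          (∀ i j, variance (fun ω => A ω i j) μ = σ ^ 2) →
          1 - ε ≤ μ.real {ω | 2 * σ * Real.sqrt n - C * Real.sqrt (Real.log n)
            ≤ lambda1 (hA.isHermitian ω)}) := by
  -- `16` comes from the bound on the expectation and one further `√(log n)` from the lower
  -- deviation.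
  refine ⟨17, ?_, ?_⟩
  · intro n hn Ω _ μ _ A hA σ hσ h0 hvar
    simp only [lambda1_eq_opNorm]
    refine ⟨hA.integrable_opNorm (by omega), ?_⟩
    have h1 := hA.le_integral_opNorm hn h0 hvar hσ
    have h2 := Real.sqrt_nonneg (Real.log n)
    linarith
  · intro ε hε
    have hlim : Filter.Tendsto (fun n : ℕ => Real.exp 16 / √(Real.log n)) Filter.atTop (nhds 0) :=
      Filter.Tendsto.const_div_atTop (Real.tendsto_sqrt_atTop.comp
        (Real.tendsto_log_atTop.comp tendsto_natCast_atTop_atTop)) _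
    obtain ⟨N, hN⟩ := Filter.eventually_atTop.1 (hlim.eventually_le_const hε)
    refine ⟨max N 2, fun n hn Ω _ μ _ A hA σ hσ h0 hvar => ?_⟩
    simp only [lambda1_eq_opNorm]
    have h1 := hA.one_sub_le_measureReal ((le_max_right N 2).trans hn) h0 hvar hσ
    have h2 := hN n ((le_max_left N 2).trans hn)
    linarith
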